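/- **Definitions.** A string is a finite sequence of integers (its letters). If $w=a_1^{m_1}a_2^{m_2}\cdots a_r^{m_r}$, where $a^m$ means $a$ repeated $m$ times, $m_i\ge 1$ and $a_i\ne a_{i+1}$, put $JHC(w)=m_1a_1m_2a_2\cdots m_ra_r$ (a string of $2r$ letters; the empty string goes to itself). A string is *$9$-day-old* if it is $JHC^9(w)$ for some string $w$. A string $LR$ *splits* as $L.R$ if $JHC^n(LR)=JHC^n(L)\,JHC^n(R)$ for all $n\ge 0$. An *atom* is a non-empty string that does not split as $L.R$ with $L$ and $R$ both non-empty. A *splitting* of a string $w$ is a finite sequence of atoms $a_1,\dots,a_s$ with $JHC^n(w)=JHC^n(a_1)\cdots JHC^n(a_s)$ for all $n\ge 0$; in particular $w=a_1\cdots a_s$. The *stable* elements are Conway's $92$ common elements, the strings with letters in $\{1,2,3\}$ spelled by the decimal digits of 22, 13112221133211322112211213322112, 312211322212221121123222112, 111312211312113221133211322112211213322112, 1321132122211322212221121123222112, 3113112211322112211213322112, 111312212221121123222112, 132112211213322112, 31121123222112, 111213322112, 123222112, 3113322112, 1113222112, 1322112, 311311222112, 1113122112, 132112, 3112, 1112,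 12, 3113112221133112, 11131221131112, 13211312, 31132, 111311222112, 13122112, 32112, 11133112, 131112, 312, 13221133122211332, 31131122211311122113222, 11131221131211322113322112, 13211321222113222112, 3113112211322112, 11131221222112, 1321122112, 3112112, 1112133, 12322211331222113112211, 1113122113322113111221131221, 13211322211312113211, 311322113212221, 132211331222113112211, 311311222113111221131221, 111312211312113211, 132113212221, 3113112211, 11131221, 13211, 3112221, 1322113312211, 311311222113111221, 11131221131211, 13211321, 311311, 11131, 1321133112, 31131112, 111312, 132, 311332, 1113222, 13221133112, 3113112221131112, 111312211312, 1321132, 311311222, 11131221133112, 1321131112, 311312, 11132, 13112221133211322112211213322113, 312211322212221121123222113, 111312211312113221133211322112211213322113, 1321132122211322212221121123222113, 3113112211322112211213322113, 111312212221121123222113, 132112211213322113, 31121123222113, 111213322113, 123222113, 3113322113, 1113222113, 1322113, 311311222113, 1113122113, 132113, 3113, 1113, 13, 3. The *transuranic* elements are the strings $31221132221222112112322211\,n$ and $1311222113321132211221121332211\,n$, where the last letter $n$ is an integer other than $1,2,3$ (so $n\ge 4$ if one starts from strings of positive integers). **Lemma.** Every atom in the splitting of a $9$-day-old string has length at most $80$.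 Every such atom $a$ decays in at most $20$ days into stable or transuranic elements: there is $k\le 20$ such that $JHC^k(a)$ has a splitting all of whose atoms are stable or transuranic. -/

import Mathlib

/-- Conway's audioactive operator: every maximal run `a, …, a` of length `m` is replaced by the two
letters `m, a`. -/
def JHC (w : List ℤ) : List ℤ :=
  (w.splitBy (· == ·)).flatMap fun run => (run.length : ℤ) :: run.take 1

/-- `L R` splits as `L . R`: the descendants of the two parts never interfere. -/
def SplitsAs (L R : List ℤ) : Prop :=
  ∀ n : ℕ, JHC^[n] (L ++ R) = JHC^[n] L ++ JHC^[n] R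

/-- An atom (element): a non-empty string without a non-trivial splitting. -/
def IsElement (w : List ℤ) : Prop :=
  w ≠ [] ∧ ∀ L R : List ℤ, w = L ++ R → SplitsAs L R → L = [] ∨ R = []

/-- `l` is the splitting of `w` into atoms: `w` is the concatenation of the atoms in `l`, and their
descendants never interfere. -/
def IsSplitting (w : List ℤ) (l : List (List ℤ)) : Prop :=
  l.flatten = w ∧ (∀ a ∈ l, IsElement a) ∧ ∀ n : ℕ, JHC^[n] w = (l.map JHC^[n]).flatten

/-- The string of the decimal digits of `n`, most significant digit first. -/
def digitString (n : ℕ) : List ℤ :=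
  (Nat.digits 10 n).reverse.map fun d => (d : ℤ)

/-- The 92 stable (common) elements, from hydrogen `22` to uranium `3`, each written as the number
with the same decimal digits. -/
def stableCodes : List ℕ :=
  [22, 13112221133211322112211213322112, 312211322212221121123222112,
   111312211312113221133211322112211213322112, 1321132122211322212221121123222112,
   3113112211322112211213322112, 111312212221121123222112, 132112211213322112, 31121123222112,
   111213322112, 123222112, 3113322112, 1113222112, 1322112, 311311222112, 1113122112, 132112,
   3112, 1112, 12, 3113112221133112, 11131221131112, 13211312, 31132, 111311222112, 13122112,
   32112, 11133112, 131112, 312, 13221133122211332, 31131122211311122113222,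
   11131221131211322113322112, 13211321222113222112, 3113112211322112, 11131221222112,
   1321122112, 3112112, 1112133, 12322211331222113112211, 1113122113322113111221131221,
   13211322211312113211, 311322113212221, 132211331222113112211, 311311222113111221131221,
   111312211312113211, 132113212221, 3113112211, 11131221, 13211, 3112221, 1322113312211,
   311311222113111221, 11131221131211, 13211321, 311311, 11131, 1321133112, 31131112, 111312,
   132, 311332, 1113222, 13221133112, 3113112221131112, 111312211312, 1321132, 311311222,
   11131221133112, 1321131112, 311312, 11132, 13112221133211322112211213322113,
   312211322212221121123222113, 111312211312113221133211322112211213322113,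
   1321132122211322212221121123222113, 3113112211322112211213322113, 111312212221121123222113,
   132112211213322113, 31121123222113, 111213322113, 123222113, 3113322113, 1113222113,
   1322113, 311311222113, 1113122113, 132113, 3113, 1113, 13, 3]

/-- A stable (common) element. -/
def IsStable (w : List ℤ) : Prop :=
  ∃ n ∈ stableCodes, w = digitString n

/-- A transuranic element: an isotope of plutonium or of neptunium, whose last letter `n` is none of
`1, 2, 3` (so `n ≥ 4` where all letters are positive). -/
def IsTransuranic (w : List ℤ) : Prop :=
  ∃ n : ℤ, n ≠ 1 ∧ n ≠ 2 ∧ n ≠ 3 ∧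
    (w = digitString 31221132221222112112322211 ++ [n] ∨
      w = digitString 1311222113321132211221121332211 ++ [n])

/-! When two strings are joined, runs merge only if the last letter of the left one equals the first
letter of the right one, and a merge makes the look-and-say string strictly shorter
(`length_JHC_append_lt`). Since `JHC` preserves the last letter of a string, `L R` splits as `L . R`
exactly when the last letter of `L` never begins a descendant of `R` (`Separated`). For a list of
non-empty strings this is a condition on neighbours only (`SepChain`). A chain of atoms refines
every chain with the same concatenation (`SepChain.exists_refine`). It is therefore enough to cut a
nine-day-old string at some of its splittings: every atom lies inside one of the pieces.

The cuts used are those that can be read off a bounded amount of data about the beginning of the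
right-hand part (`Head`). They rest on two closed classes: strings `2 2 v` with `v` empty or never
beginning with `2`, whose descendants keep this form, and the three-day cycle `1 x ...`, `1 1 1
...`, `3 ...`, which avoids an initial `2`. After a letter other than `1`, `2`, `3` almost every cut
splits, since counts are at most `3` from the second day on. Such letters survive only at the ends
of pieces, so one symbol `other` can stand for all of them.

The pieces that arise after `n` days, for `n` from `2` to `9`, are contained in the language of a
finite automaton. The tables of these automata are certificates, and only inclusions are verified.
The look-and-say strings of all strings accepted by one automaton are written by a finite machine
(`tableSource`), and a search of its product with the next automaton shows that all their pieces are
accepted there. For two-day-old strings the machine (`baseSource`) comes from the run structure of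
one-day-old strings.

The language of the last automaton is finite. Enumerating it gives length at most `80` and decay in
`20` days into the final words, that is, the stable and transuranic elements
(`acceptedDecay_table9`). These are themselves atoms and decay into one another
(`finalWordsCheck_eq_true`). Refinement, applied on day `9` and again `20` days later, transfers
both facts from pieces to atoms. -/

/-! ### Look-and-say strings: runs, first and last letters, lengths -/

/-- The effect on the look-and-say string `JHC w` of putting the letter `x` in front of `w`. -/
def pushLetter (x : ℤ) : List ℤ → List ℤ
  | m :: c :: t => if x = c then (m + 1) :: c :: t else 1 :: x :: m :: c :: t
  | t => 1 :: x :: t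

theorem JHC_nil : JHC [] = [] := by simp [JHC]

theorem JHC_append_of_ne {u v : List ℤ} (h : ∀ x ∈ u.getLast?, x ∉ v.head?) :
    JHC (u ++ v) = JHC u ++ JHC v := by
  rcases eq_or_ne u [] with rfl | hu
  · simp [JHC_nil]
  rcases eq_or_ne v [] with rfl | hv
  · simp [JHC_nil]
  unfold JHC
  rw [List.splitBy_append, List.flatMap_append]
  intro x hx y hy
  rw [beq_eq_false_iff_ne]
  rintro rfl
  exact h x hx hy

theorem JHC_replicate {m : ℕ} (hm : m ≠ 0) (c : ℤ) : JHC (List.replicate m c) = [(m : ℤ), c] := by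
  obtain ⟨k, rfl⟩ := Nat.exists_eq_succ_of_ne_zero hm
  unfold JHC
  rw [List.splitBy_of_isChain]
  · simp [List.replicate_succ]
  · simp
  · simp [List.isChain_replicate_of_rel]

/-- Every non-empty string starts with a maximal run. -/
theorem exists_run (x : ℤ) (w : List ℤ) :
    ∃ (m : ℕ) (v : List ℤ), x :: w = List.replicate (m + 1) x ++ v ∧ x ∉ v.head? := by
  induction w with
  | nil => exact ⟨0, [], by simp⟩
  | cons y w ih =>
    by_cases hxy : x = y
    · subst hxy
      obtain ⟨m, v, h, hv⟩ := ih
      exact ⟨m + 1, v, by rw [h]; simp [List.replicate_succ], hv⟩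
    · exact ⟨0, y :: w, by simp, by simpa [eq_comm] using hxy⟩

theorem JHC_run {m : ℕ} (hm : m ≠ 0) {c : ℤ} {v : List ℤ} (h : c ∉ v.head?) :
    JHC (List.replicate m c ++ v) = (m : ℤ) :: c :: JHC v := by
  rw [JHC_append_of_ne, JHC_replicate hm]
  · rfl
  · intro x hx
    rw [List.getLast?_replicate] at hx
    simp_all

/-- This makes `JHC` a right fold, the form in which inductions on strings and the computations with
words use it. -/
theorem JHC_cons (x : ℤ) (w : List ℤ) : JHC (x :: w) = pushLetter x (JHC w) := by
  cases w with
  | nil =>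
    have := JHC_replicate (m := 1) (by simp) x
    simpa [JHC_nil, pushLetter] using this
  | cons y w =>
    obtain ⟨m, v, h, hv⟩ := exists_run y w
    rw [h, JHC_run (by simp) hv]
    by_cases hxy : x = y
    · subst hxy
      have : x :: (List.replicate (m + 1) x ++ v) = List.replicate (m + 2) x ++ v := by
        simp [List.replicate_succ]
      rw [this, JHC_run (by simp) hv]
      simp [pushLetter]
      ring
    · have := JHC_run (m := 1) (by simp) (c := x) (v := List.replicate (m + 1) y ++ v)
        (by simpa [List.replicate_succ, eq_comm] using hxy)
      rw [JHC_run (by simp) hv] at this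
      simpa [pushLetter, hxy] using this

theorem JHC_ne_nil {w : List ℤ} (h : w ≠ []) : JHC w ≠ [] := by
  cases w with
  | nil => exact absurd rfl h
  | cons x w =>
    rw [JHC_cons]
    unfold pushLetter
    split <;> [split_ifs; skip] <;> simp

/-- Look-and-say strings of non-empty strings begin with a count and the first letter. -/
theorem exists_JHC_cons (x : ℤ) (w : List ℤ) :
    ∃ (m : ℤ) (t : List ℤ), JHC (x :: w) = m :: x :: t := by
  obtain ⟨m, v, h, hv⟩ := exists_run x w
  rw [h, JHC_run (by simp) hv]
  exact ⟨_, _, rfl⟩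

theorem pushLetter_cons_cons (x m c : ℤ) (t : List ℤ) : pushLetter x (m :: c :: t) =
    if x = c then (m + 1) :: c :: t else 1 :: x :: m :: c :: t := rfl

/-- The last letter is the value of the last run, and values are copied. This invariance is what
lets splitting be decided by the descendants of the right-hand part alone. -/
theorem getLast?_JHC (w : List ℤ) : (JHC w).getLast? = w.getLast? := by
  induction w with
  | nil => simp [JHC_nil]
  | cons x w ih =>
    cases w with
    | nil => rw [JHC_cons, JHC_nil]; rfl
    | cons y w =>
      obtain ⟨m, t, h⟩ := exists_JHC_cons y w
      rw [JHC_cons]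
      rw [h] at ih ⊢
      rw [pushLetter_cons_cons]
      split_ifs <;> simp_all [List.getLast?_cons_cons]

/-- The two runs at the seam become one, so one count and one value are lost. A length comparison
thus detects interference. -/
theorem length_JHC_append_lt {u v : List ℤ} {x : ℤ} (hu : x ∈ u.getLast?) (hv : x ∈ v.head?) :
    (JHC (u ++ v)).length < (JHC u ++ JHC v).length := by
  obtain ⟨v, rfl⟩ : ∃ t, v = x :: t := by
    cases v <;> simp_all
  obtain ⟨b, t, hb⟩ := exists_JHC_cons x v
  induction u with
  | nil => simp at hu
  | cons y u ih =>
    cases u with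
    | nil =>
      obtain rfl : y = x := by simpa using hu
      rw [List.cons_append, List.nil_append, JHC_cons y (y :: v), JHC_cons y [], hb, JHC_nil,
        pushLetter_cons_cons]
      simp [pushLetter]
    | cons z u =>
      have := ih (by simpa [List.getLast?_cons_cons] using hu)
      obtain ⟨m, s, h⟩ := exists_JHC_cons z (u ++ x :: v)
      obtain ⟨m', s', h'⟩ := exists_JHC_cons z u
      rw [List.cons_append, JHC_cons y, JHC_cons y, List.cons_append, h, h']
      rw [List.cons_append, h, h'] at this
      rw [pushLetter_cons_cons, pushLetter_cons_cons]
      split_ifs <;> simp_all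

theorem iterate_JHC_nil (n : ℕ) : JHC^[n] [] = [] := Function.iterate_fixed JHC_nil n

theorem iterate_JHC_ne_nil {w : List ℤ} (h : w ≠ []) (n : ℕ) : JHC^[n] w ≠ [] := by
  induction n with
  | zero => exact h
  | succ n ih => rw [Function.iterate_succ_apply']; exact JHC_ne_nil ih

theorem getLast?_iterate_JHC (w : List ℤ) (n : ℕ) : (JHC^[n] w).getLast? = w.getLast? := by
  induction n with
  | zero => rfl
  | succ n ih => rw [Function.iterate_succ_apply', getLast?_JHC, ih]

/-! ### Splittings as separation of neighbours -/

/-- The last letter of `L`, which never changes, is never the first letter of a descendant of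
`R`. -/
def Separated (L R : List ℤ) : Prop :=
  ∀ n : ℕ, ∀ x ∈ L.getLast?, x ∉ (JHC^[n] R).head?

theorem Separated.splitsAs {L R : List ℤ} (h : Separated L R) : SplitsAs L R := by
  intro n
  induction n with
  | zero => rfl
  | succ n ih =>
    simp only [Function.iterate_succ_apply']
    rw [ih, JHC_append_of_ne]
    intro x hx
    exact h n x (by rwa [getLast?_iterate_JHC] at hx)

/-- If the descendants met in equal letters on day `n`, the string of day `n + 1` would be too
short. -/
theorem SplitsAs.separated {L R : List ℤ} (h : SplitsAs L R) : Separated L R := by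
  intro n x hx hR
  have h1 := h (n + 1)
  rw [Function.iterate_succ_apply', h n, Function.iterate_succ_apply',
    Function.iterate_succ_apply'] at h1
  have := length_JHC_append_lt (u := JHC^[n] L) (v := JHC^[n] R) (x := x)
    (by rwa [getLast?_iterate_JHC]) hR
  rw [h1] at this
  exact lt_irrefl _ this

theorem Separated.iterate {L R : List ℤ} (h : Separated L R) (k : ℕ) :
    Separated (JHC^[k] L) (JHC^[k] R) := by
  intro n x hx
  rw [getLast?_iterate_JHC] at hx
  rw [← Function.iterate_add_apply]
  exact h _ x hx

/-- A list of non-empty strings whose descendants never interfere. -/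
def SepChain (l : List (List ℤ)) : Prop :=
  [] ∉ l ∧ l.IsChain Separated

theorem SepChain.tail {a : List ℤ} {l : List (List ℤ)} (h : SepChain (a :: l)) : SepChain l :=
  ⟨fun h' => h.1 (List.mem_cons_of_mem _ h'), h.2.tail⟩

theorem sepChain_nil : SepChain [] := ⟨by simp, by simp⟩

theorem SepChain.iterate {l : List (List ℤ)} (h : SepChain l) (k : ℕ) :
    SepChain (l.map JHC^[k]) := by
  refine ⟨fun h' => ?_, ?_⟩
  · obtain ⟨a, ha, he⟩ := List.mem_map.1 h'
    exact iterate_JHC_ne_nil (fun h0 => h.1 (h0 ▸ ha)) k he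
  · rw [List.isChain_map]
    exact h.2.imp fun _ _ hab => hab.iterate k

theorem SepChain.JHC_flatten {l : List (List ℤ)} (h : SepChain l) :
    JHC l.flatten = (l.map JHC).flatten := by
  induction l with
  | nil => simp [JHC_nil]
  | cons a l ih =>
    rw [List.flatten_cons, JHC_append_of_ne, ih h.tail, List.map_cons, List.flatten_cons]
    intro x hx
    cases l with
    | nil => simp
    | cons b l =>
      have hb : b ≠ [] := fun hb => h.1 (by simp [hb])
      have := (List.isChain_cons_cons.1 h.2).1 0 x hx
      rwa [List.flatten_cons, List.head?_append_of_ne_nil _ hb]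

theorem SepChain.iterate_flatten {l : List (List ℤ)} (h : SepChain l) (n : ℕ) :
    JHC^[n] l.flatten = (l.map JHC^[n]).flatten := by
  induction n with
  | zero => simp
  | succ n ih =>
    rw [Function.iterate_succ_apply', ih, (h.iterate n).JHC_flatten, List.map_map,
      Function.iterate_succ']

/-- The descendants of the first member after `a` never become empty, so they alone provide the
first letter of the descendants of the rest. -/
theorem SepChain.separated {a : List ℤ} {l : List (List ℤ)} (h : SepChain (a :: l)) :
    Separated a l.flatten := by
  intro n x hx
  rw [h.tail.iterate_flatten]
  cases l with
  | nil => simp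
  | cons b l =>
    have hb : b ≠ [] := fun hb => h.1 (by simp [hb])
    rw [List.map_cons, List.flatten_cons, List.head?_append_of_ne_nil _ (iterate_JHC_ne_nil hb n)]
    exact (List.isChain_cons_cons.1 h.2).1 n x hx

theorem Separated.of_append_left {a b c : List ℤ} (h : Separated a (b ++ c)) (hb : b ≠ [])
    (hbc : Separated b c) : Separated a b := by
  intro n x hx
  have := h n x hx
  rwa [hbc.splitsAs n, List.head?_append_of_ne_nil _ (iterate_JHC_ne_nil hb n)] at this

theorem Separated.of_suffix {a b c : List ℤ} (h : Separated (a ++ b) c) (hb : b ≠ []) :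
    Separated b c := by
  intro n x hx
  exact h n x (by rwa [List.getLast?_append_of_ne_nil _ hb])

theorem sepChain_cons {a : List ℤ} {l : List (List ℤ)} (ha : a ≠ []) (hl : SepChain l)
    (h : Separated a l.flatten) : SepChain (a :: l) := by
  refine ⟨by simpa [eq_comm, ha] using hl.1, ?_⟩
  cases l with
  | nil => simp
  | cons b l =>
    refine List.isChain_cons_cons.2 ⟨?_, hl.2⟩
    exact h.of_append_left (fun hb => hl.1 (by simp [hb])) hl.separated

theorem length_JHC_append_le (u v : List ℤ) :
    (JHC (u ++ v)).length ≤ (JHC u).length + (JHC v).length := by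
  by_cases h : ∀ x ∈ u.getLast?, x ∉ v.head?
  · rw [JHC_append_of_ne h, List.length_append]
  · push Not at h
    obtain ⟨x, hu, hv⟩ := h
    simpa using (length_JHC_append_lt hu hv).le

theorem length_JHC_flatten_le (l : List (List ℤ)) :
    (JHC l.flatten).length ≤ (l.map JHC).flatten.length := by
  induction l with
  | nil => simp [JHC_nil]
  | cons a l ih =>
    have := length_JHC_append_le a l.flatten
    simp only [List.flatten_cons, List.map_cons, List.length_append]
    omega

/-- `JHC` is subadditive in length, with a strict loss at every seam where runs merge; equality
therefore excludes a merge at each seam. -/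
theorem isChain_of_JHC_flatten {l : List (List ℤ)} (hl : [] ∉ l)
    (h : JHC l.flatten = (l.map JHC).flatten) :
    l.IsChain fun a b => ∀ x ∈ a.getLast?, x ∉ b.head? := by
  induction l with
  | nil => simp
  | cons a l ih =>
    have hsep : ∀ x ∈ a.getLast?, x ∉ l.flatten.head? := by
      intro x hx hx'
      have h1 := length_JHC_append_lt hx hx'
      have h2 := length_JHC_flatten_le l
      have h3 := congrArg List.length h
      simp only [List.flatten_cons, List.map_cons, List.length_append] at h1 h2 h3
      omega
    have ih := ih (fun h' => hl (List.mem_cons_of_mem _ h')) (by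
      rw [List.flatten_cons, JHC_append_of_ne hsep, List.map_cons, List.flatten_cons] at h
      exact List.append_cancel_left h)
    cases l with
    | nil => simp
    | cons b l =>
      have hb : b ≠ [] := fun hb => hl (by simp [hb])
      rw [List.flatten_cons, List.head?_append_of_ne_nil _ hb] at hsep
      exact List.isChain_cons_cons.2 ⟨hsep, ih⟩

theorem List.isChain_forall {α ι : Type*} {R : ι → α → α → Prop} {l : List α}
    (h : ∀ i, l.IsChain (R i)) : l.IsChain fun a b => ∀ i, R i a b := by
  induction l with
  | nil => simp
  | cons a l ih =>
    cases l with
    | nil => simp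
    | cons b l =>
      exact List.isChain_cons_cons.2
        ⟨fun i => (List.isChain_cons_cons.1 (h i)).1, ih fun i => (h i).tail⟩

/-- Comparing day `n + 1` with day `n` shows that no seam merges on day `n`. As last letters are
constant, this is separation of neighbours. -/
theorem IsSplitting.sepChain {w : List ℤ} {l : List (List ℤ)} (h : IsSplitting w l) :
    SepChain l := by
  obtain ⟨-, hel, hn⟩ := h
  have hnil : [] ∉ l := fun h' => (hel _ h').1 rfl
  refine ⟨hnil, List.isChain_forall fun n => ?_⟩
  have h1 := isChain_of_JHC_flatten (l := l.map JHC^[n])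
    (fun h' => by
      obtain ⟨a, ha, he⟩ := List.mem_map.1 h'
      exact iterate_JHC_ne_nil (fun h0 => hnil (h0 ▸ ha)) n he)
    (by
      have := hn (n + 1)
      rwa [Function.iterate_succ_apply', hn n, Function.iterate_succ', ← List.map_map] at this)
  rw [List.isChain_map] at h1
  exact h1.imp fun a b hab x hx => hab x (by rwa [getLast?_iterate_JHC])

theorem SepChain.isSplitting {l : List (List ℤ)} (h : SepChain l) (hel : ∀ a ∈ l, IsElement a) :
    IsSplitting l.flatten l :=
  ⟨rfl, hel, h.iterate_flatten⟩

/-- A chain of elements refines every chain with the same concatenation. -/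
theorem SepChain.exists_refine {m : List (List ℤ)} (hm : SepChain m)
    (hel : ∀ a ∈ m, IsElement a) {l : List (List ℤ)} (hl : SepChain l)
    (h : m.flatten = l.flatten) :
    ∃ d : List (List (List ℤ)), d.flatten = m ∧ d.map List.flatten = l := by
  induction m generalizing l with
  | nil =>
    cases l with
    | nil => exact ⟨[], rfl, rfl⟩
    | cons a l =>
      have : a = [] := by
        have : ([] : List ℤ) = a ++ l.flatten := by simpa using h
        simp_all
      exact absurd (by simp [this]) hl.1
  | cons b m ih =>
    cases l with
    | nil =>
      have : b = [] := by simp_all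
      exact absurd (by simp [this]) hm.1
    | cons a l =>
      have ha : a ≠ [] := fun h0 => hl.1 (by simp [h0])
      have hb : b ≠ [] := fun h0 => hm.1 (by simp [h0])
      have h' : b ++ m.flatten = a ++ l.flatten := h
      have helm : ∀ a ∈ m, IsElement a := fun a ha => hel a (List.mem_cons_of_mem _ ha)
      obtain ⟨c, rfl, hc⟩ | ⟨c, rfl, hc⟩ := List.append_eq_append_iff.1 h'
      · -- the element `b` is a prefix of `a`
        rcases eq_or_ne c [] with rfl | hc0
        · obtain ⟨d, hd, hd'⟩ := ih hm.tail helm hl.tail (by simpa using hc)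
          exact ⟨[b] :: d, by simp [hd], by simp [hd']⟩
        · have hcl : SepChain (c :: l) :=
            sepChain_cons hc0 hl.tail (hl.separated.of_suffix hc0)
          obtain ⟨d, hd, hd'⟩ := ih hm.tail helm hcl (by simpa using hc)
          cases d with
          | nil => simp at hd'
          | cons e d =>
            simp only [List.map_cons, List.cons.injEq] at hd'
            exact ⟨(b :: e) :: d, by simpa using hd, by simp [hd']⟩
      · rcases eq_or_ne c [] with rfl | hc0
        · obtain ⟨d, hd, hd'⟩ := ih hm.tail helm hl.tail (by simpa using hc.symm)
          exact ⟨[a] :: d, by simp [hd], by simp [hd']⟩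
        -- Here `a` is a proper prefix of the atom `b = a ++ c`. The chain `l` would make `a . c` a
        -- splitting of this atom.
        · have hs : Separated a (c ++ m.flatten) := hc ▸ hl.separated
          have hac : Separated a c := hs.of_append_left hc0 (hm.separated.of_suffix hc0)
          rcases (hel (a ++ c) (by simp)).2 a c rfl hac.splitsAs with h0 | h0
          · exact absurd h0 ha
          · exact absurd h0 hc0

/-- Chains may be concatenated along a chain of their concatenations. -/
theorem SepChain.flatten {d : List (List (List ℤ))} (hd : ∀ l ∈ d, SepChain l)
    (h : SepChain (d.map List.flatten)) : SepChain d.flatten := by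
  induction d with
  | nil => exact sepChain_nil
  | cons l d ih =>
    have ih := ih (fun l hl => hd l (List.mem_cons_of_mem _ hl)) h.tail
    have hs := h.separated
    have hl := hd l (by simp)
    clear hd h
    rw [List.flatten_cons]
    induction l with
    | nil => simpa using ih
    | cons a l ihl =>
      have ha : a ≠ [] := fun h0 => hl.1 (by simp [h0])
      rcases eq_or_ne l.flatten [] with h0 | h0
      · have : l = [] := by
          cases l with
          | nil => rfl
          | cons b l => exact absurd (show [] ∈ a :: b :: l by simp_all) hl.1
        subst this
        refine sepChain_cons ha (by simpa using ih) ?_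
        simpa [List.flatten_flatten] using hs
      · have hs' : Separated l.flatten (d.map List.flatten).flatten := by
          rw [List.flatten_cons] at hs
          exact hs.of_suffix h0
        refine sepChain_cons ha (ihl hs' hl.tail) ?_
        have := hl.separated
        intro n x hx
        rw [show (l.append d.flatten).flatten = l.flatten ++ (d.map List.flatten).flatten by
          rw [List.append_eq, List.flatten_append, List.flatten_flatten], hs'.splitsAs n,
          List.head?_append_of_ne_nil _ (iterate_JHC_ne_nil h0 n)]
        exact this n x hx

/-! ### The finite alphabet and the data that recognize splittings -/

/-- The letters `1`, `2`, `3`, and a symbol for every other letter. -/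
inductive Letter
  | one | two | three | other

namespace Letter

/-- Equality of letters as a Boolean. -/
def beq : Letter → Letter → Bool
  | one, y => match y with | one => true | two => false | three => false | other => false
  | two, y => match y with | one => false | two => true | three => false | other => false
  | three, y => match y with | one => false | two => false | three => true | other => false
  | other, y => match y with | one => false | two => false | three => false | other => true

/-- The letter after a given one; the successor of `3` is not one of `1`, `2`, `3`. -/
def succ : Letter → Letter
  | one => two
  | two => three
  | three => other
  | other => other

/-- The decimal digit for a letter, with `4` in place of all letters other than `1`, `2`, `3`. -/
def toNat : Letter → ℕ
  | one => 1
  | two => 2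
  | three => 3
  | other => 4

end Letter

open Letter

/-- What has to be known about the beginning of a string `c ^ m ...` in order to recognize
splittings: the first letter `c`, the lengths `m` and `m'` of the first and the second run (`other`
for lengths that exceed `3`, and for a missing second run), and whether the string after the first
run is empty or of the kind recognized by `avoidsTwo`. -/
inductive Head
  | empty
  | run (c m m' : Letter) (b : Bool)

namespace Head

/-- Whether a string with the given beginning is recognized to have no descendant that begins
with `2`. -/
def avoidsTwo (c m m' : Letter) : Bool :=
  match c with
  | one => match m with
    | one => m'.beq one
    | two => false
    | three => true
    | other => false
  | two => false
  | three => match m with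
    | one => !m'.beq three
    | two => false
    | three => false
    | other => false
  | other => m.beq one && m'.beq other

/-- The beginning of `x :: w`, from the beginning of `w`. -/
def push (x : Letter) : Head → Head
  | empty => run x one other true
  | run c m m' b => bif x.beq c then run c m.succ m' b else run x one m (avoidsTwo c m m')

/-- Whether a string that ends in `x` is recognized to split from a string with the given
beginning. -/
def splits (x : Letter) : Head → Bool
  | empty => false
  | run c m m' b => match x with
    | one => c.beq two && m.beq two && b
    | two => avoidsTwo c m m'
    | three => c.beq two && m.beq two && b
    | other => !c.beq other && !m.beq other

/-- An injective numbering. -/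
def toNat : Head → ℕ
  | empty => 0
  | run c m m' b =>
    Nat.add (Nat.mul 64 c.toNat) (Nat.add (Nat.mul 16 m.toNat)
      (Nat.add (Nat.mul 2 m'.toNat) (bif b then 1 else 0)))

/-- Equality as a Boolean. -/
def beq : Head → Head → Bool
  | empty, t => match t with | empty => true | run _ _ _ _ => false
  | run c m m' b, t => match t with
    | empty => false
    | run c₁ m₁ m₁' b₁ => c.beq c₁ && m.beq m₁ && m'.beq m₁' && (bif b then b₁ else !b₁)

end Head

/-- The beginning of a string. -/
def headOf (w : List Letter) : Head :=
  w.foldr Head.push Head.empty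

/-! ### Automata -/

/-- Apply `f` to the value of `n`: a device for call-by-value evaluation. -/
def forceNat {α : Type} (n : ℕ) (f : ℕ → α) : α :=
  Nat.rec (f 0) (fun k _ => f (Nat.succ k)) n

/-- Apply `f` to the value of a letter. -/
def forceLetter {α : Type} (x : Letter) (f : Letter → α) : α :=
  match x with
  | one => f one
  | two => f two
  | three => f three
  | other => f other

/-- Apply `f` to the value of `b`. -/
def forceBool {α : Type} (b : Bool) (f : Bool → α) : α :=
  match b with
  | true => f true
  | false => f false

/-- Apply `f` to the value of `t`. -/
def forceHead {α : Type} (t : Head) (f : Head → α) : α :=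
  match t with
  | .empty => f .empty
  | .run c m m' b =>
    forceLetter c fun c => forceLetter m fun m => forceLetter m' fun m' => forceBool b fun b =>
      f (.run c m m' b)

/-- The automaton with table `T` reads strings from right to left. Its row `q` consists of the bits
`32 q, …, 32 q + 31` of `T`: the successors of the state `q` for the letters `1`, `2`, `3`, of ten
bits each, then a bit for acceptance. State `0` is dead, state `1` is initial, and the letter
`other` is read in state `1` only, where it leads to the state `2`. -/
def next (T q : ℕ) (x : Letter) : ℕ :=
  match x with
  | one => Nat.land (Nat.shiftRight T (Nat.mul 32 q)) 1023
  | two => Nat.land (Nat.shiftRight T (Nat.add (Nat.mul 32 q) 10)) 1023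
  | three => Nat.land (Nat.shiftRight T (Nat.add (Nat.mul 32 q) 20)) 1023
  | other => bif Nat.beq q 1 then 2 else 0

/-- Whether the state `q` is accepting. -/
def accepting (T q : ℕ) : Bool :=
  Nat.beq (Nat.land (Nat.shiftRight T (Nat.add (Nat.mul 32 q) 30)) 1) 1

/-- Reading the letter `x` into a string of pieces, the leftmost of which has led to the state `q`
and has the beginning `t`. -/
def feed (T q : ℕ) (t : Head) (x : Letter) (k : ℕ → Head → Bool) : Bool :=
  bif t.splits x then
    accepting T q && forceNat (next T 1 x) fun q' =>
      !Nat.beq q' 0 && k q' (.run x one other true)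
  else bif x.beq other && !t.beq .empty then false
  else forceNat (next T q x) fun q' => !Nat.beq q' 0 && forceHead (t.push x) fun t' => k q' t'

/-- Binary search trees. -/
inductive SearchTree (α : Type)
  | leaf
  | node (l : SearchTree α) (key : ℕ) (a : α) (r : SearchTree α)

namespace SearchTree

variable {α : Type}

/-- Insert an element with its key, unless it is there already. -/
def insertNew (eq : α → α → Bool) (key : ℕ) (a : α) : SearchTree α → Option (SearchTree α)
  | leaf => some (node leaf key a leaf)
  | node l k b r =>
    bif Nat.ble k key then
      bif Nat.beq k key && eq a b then none
      else match insertNew eq key a r with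
        | none => none
        | some r' => some (node l k b r')
    else match insertNew eq key a l with
      | none => none
      | some l' => some (node l' k b r)

end SearchTree

/-! ### Sources and the search of their products with automata -/

/-- A machine that writes strings from right to left, two letters at a time. -/
structure Source (σ : Type) where
  /-- the initial state -/
  init : σ
  /-- the possible moves: the last two letters and the new state -/
  moves : σ → List (Letter × Letter × σ)
  /-- whether the machine may stop -/
  final : σ → Bool
  /-- equality of states -/
  eq : σ → σ → Bool
  /-- a numbering of the states -/
  key : σ → ℕ

variable {σ : Type}

/-- The nodes of the product of a source and an automaton. -/
structure ProductNode (σ : Type) where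
  /-- the state of the source -/
  src : σ
  /-- the state of the automaton -/
  state : ℕ
  /-- the beginning of the current piece -/
  head : Head

/-- Equality of nodes. -/
def ProductNode.beq (eq : σ → σ → Bool) (a b : ProductNode σ) : Bool :=
  eq a.src b.src && Nat.beq a.state b.state && a.head.beq b.head

/-- A search key. -/
def ProductNode.key (f : σ → ℕ) (a : ProductNode σ) : ℕ :=
  Nat.mod (Nat.mul 2654435761 (Nat.add (Nat.mul (f a.src) 524288)
    (Nat.add (Nat.mul a.head.toNat 1024) a.state))) 4294967296

/-- Add the successors of a node to the lists of unfinished and of known nodes. -/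
def Source.expand (S : Source σ) (T q : ℕ) (t : Head)
    (k : List (ProductNode σ) → SearchTree (ProductNode σ) → Bool) :
    List (Letter × Letter × σ) → List (ProductNode σ) → SearchTree (ProductNode σ) → Bool
  | [], todo, known => k todo known
  | (c, m, s) :: l, todo, known =>
    !m.beq other && feed T q t c fun q₁ t₁ => feed T q₁ t₁ m fun q₂ t₂ =>
      forceNat (ProductNode.key S.key ⟨s, q₂, t₂⟩) fun key =>
        match known.insertNew (ProductNode.beq S.eq) key ⟨s, q₂, t₂⟩ with
        | none => S.expand T q t k l todo known
        | some known' => S.expand T q t k l (⟨s, q₂, t₂⟩ :: todo) known'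

/-- Exhaust the nodes of the product. -/
def Source.search (S : Source σ) (T : ℕ) :
    ℕ → List (ProductNode σ) → SearchTree (ProductNode σ) → Bool
  | _, [], _ => true
  | 0, _ :: _, _ => false
  | n + 1, a :: todo, known =>
    (!S.final a.src || a.head.beq .empty || accepting T a.state) &&
      S.expand T a.state a.head (S.search T n) (S.moves a.src) todo known

/-- Whether all strings written by the source consist of pieces accepted by the automaton. -/
def Source.check (S : Source σ) (T : ℕ) (n : ℕ) : Bool :=
  forceNat T fun T =>
    S.search T n [⟨S.init, 1, .empty⟩]
      (.node .leaf (ProductNode.key S.key ⟨S.init, 1, .empty⟩) ⟨S.init, 1, .empty⟩ .leaf)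

/-- Whether the automaton may stop in state `q`, or go on with a letter other than `x`. -/
def live (T : ℕ) (x : Letter) (q : ℕ) : Bool :=
  bif accepting T q then true else
  match x with
  | one => !Nat.beq (Nat.add (next T q two) (next T q three)) 0
  | two => !Nat.beq (Nat.add (next T q one) (next T q three)) 0
  | three => !Nat.beq (Nat.add (next T q one) (next T q two)) 0
  | other => true

/-- The moves that read runs of the letter `x`, with lengths from a list; the move for longer runs
has length `other`. -/
def runMoves (T : ℕ) (x : Letter) : List Letter → ℕ → List (Letter × Letter × ℕ × Letter) →
    List (Letter × Letter × ℕ × Letter)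
  | [], q, l => bif Nat.beq (next T q x) 0 then l else (x, other, 0, x) :: l
  | m :: ms, q, l => forceNat (next T q x) fun q' =>
      bif Nat.beq q' 0 then l
      else bif live T x q' then (x, m, q', x) :: runMoves T x ms q' l
      else runMoves T x ms q' l

/-- The look-and-say strings of the strings accepted by the automaton, as a source. The states
consist of the state of the automaton and the last letter read. -/
def tableSource (T : ℕ) : Source (ℕ × Letter) where
  init := (1, other)
  moves s := match s with
    | (q, c) => match c with
      | one => runMoves T two [one, two, three] q (runMoves T three [one, two, three] q [])
      | two => runMoves T one [one, two, three] q (runMoves T three [one, two, three] q [])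
      | three => runMoves T one [one, two, three] q (runMoves T two [one, two, three] q [])
      | other => runMoves T one [one, two, three] q <| runMoves T two [one, two, three] q <|
          runMoves T three [one, two, three] q <|
            bif Nat.beq q 1 then [(other, one, 2, other)] else []
  final s := accepting T s.1
  eq s s' := Nat.beq s.1 s'.1 && s.2.beq s'.2
  key s := Nat.add (Nat.mul 4 s.1) s.2.toNat

/-- The states of the source of two-day-old strings. The string of the day before consists of
counts and values in turn, and the source has written the next day's version of an end segment of
it that consists of complete runs. The state says whether this segment begins with a count, and
with which letter it begins; for a count that is a run of its own, `y` is the value after it. -/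
inductive BaseState
  | init
  | count (c : Letter)
  | loneCount (c y : Letter)
  | value (c : Letter)

namespace BaseState

/-- Equality of states as a Boolean. -/
def beq : BaseState → BaseState → Bool
  | init, s => match s with
    | init => true | count _ => false | loneCount _ _ => false | value _ => false
  | count c, s => match s with
    | init => false | count c' => c.beq c' | loneCount _ _ => false | value _ => false
  | loneCount c y, s => match s with
    | init => false | count _ => false | loneCount c' y' => c.beq c' && y.beq y'
    | value _ => false
  | value c, s => match s with
    | init => false | count _ => false | loneCount _ _ => false | value c' => c.beq c'

/-- A numbering. -/
def toNat : BaseState → ℕ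
  | init => 0
  | count c => c.toNat
  | loneCount c y => Nat.add (Nat.mul 8 c.toNat) y.toNat
  | value c => Nat.add 64 c.toNat

/-- All letters, except for `c` if this is one of `1`, `2`, `3`. -/
def lettersExcept (c : Letter) (l : List Letter) : List Letter :=
  l.filter fun x => x.beq other || !x.beq c

/-- The possible moves. -/
def moves : BaseState → List (Letter × Letter × BaseState)
  | init => [one, two, three, other].flatMap fun x => [(x, one, value x), (x, two, count x)]
  | count c => (lettersExcept c [one, two, three, other]).flatMap fun x =>
      [(x, one, value x), (x, two, count x)]
  | loneCount c y => (lettersExcept y (lettersExcept c [one, two, three, other])).flatMap fun x =>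
      [(x, one, value x), (x, two, count x)]
  | value c => (lettersExcept c [one, two, three, other]).flatMap fun x =>
      [(x, one, loneCount x c), (x, two, value x), (x, three, count x)]

/-- The strings begin with a count. -/
def final : BaseState → Bool
  | init => true
  | count _ => true
  | loneCount _ _ => true
  | value _ => false

end BaseState

/-- The two-day-old strings as a source. -/
def baseSource : Source BaseState where
  init := .init
  moves := BaseState.moves
  final := BaseState.final
  eq := BaseState.beq
  key := BaseState.toNat

/-! ### The certificates: automata for days 2 to 9, ten states to each digit -/

/-- Assemble a number from its digits, least significant digit first. -/
def joinRows (l : List ℕ) : ℕ :=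
  l.foldr (fun x n => Nat.add x (Nat.shiftLeft n 320)) 0

/-- The automaton for the pieces of 2-day-old strings. -/
def table2 : ℕ := joinRows [
  0x4000000002e02809400000080400bc074060000045e1040546117c044290006d06a1880300000000,
  0x41400000000054134000001204008c1102e0280c4100000f4000000740d000000290380c42d02c00,
  0x42d078004000001d4000581c00006c0741a0000002e02819420000180000841740d0580004008c09,
  0x40d0002200009c174000980042e000254000a0240000541d41a00022440000114200000f02907c0c,
  0x42d0c80042e000314000ec3042a000004400000902907c114000b00800006c2b42a0001c02903811,
  0x290f83c4400000743a0780002e17c394340003802e17c134000003644000035434000180290dc33,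
  0x42a0000744502819461028444460f84345d1080c400098220400bc3543f0003802e17c054200003d,
  0x454140094000004f42a0004e4550001144c028444200844b44d1280c42d124134000004845500047,
  0x4200005a40016c5944d1281140015c4f40016056455000094550001c4450280c446038524531440c,
  0x4610006446a1a463455000350290f83343a18000455000074550004e4200545a40d0845c45414019,
  0x4340003d454104134000006c4550006b4000f80045e1401946117c6846a0f86745d1983345e19405]

/-- The automaton for the pieces of 3-day-old strings. -/
def table3 : ℕ := joinRows [
  0x4000000006502809400000080001a0074060000049a1a4054a026c04000000e40d82840300000000,
  0x400000144130000003a0581206404400009040094000000f4000000e40d0000004e1280c06402c00,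
  0x41307800000074094000001c0000d01b0000000e419000000000001801a000170000000940000015,
  0x650a009400000270001a02603a07c120640900000006023425000224000001b020000170000841f,
  0x320a81b0000c40f0000003042f000004000002642d0000002e0402c0000002b0320a8180000a400,
  0x4000002343c0003b42d00022020000270000e4384000dc00409000360000c4354000002842f00033,
  0x4600012045400110000000d0094420000000010c414000004003a0e03f0000f8270001a03d,
  0x400000504530004f4000000744d0000002e0404c01a0004b00007428419000494250000002e04047,
  0x1705a41316400000160414000005704e17c56000154080001a0540200004b04e1480c06414400,
  0x1540f0001a063462000000610282c0200006040d07800000178504060005d02e040050200005b,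
  0x42f0001b44d0001846d0406c08d1b86b4971a80c400110330000f8150001a0674660000040000009,
  0x40000078477000170321f4764131d4000651d009400000730002047240d09000000060704710006f,
  0x40021c8240d0440042d0900002e2007f4250007e4200001703a1b87c4131ec000091e80940000079,
  0x2e1e88c4190008b02e1e847400000890322288842d0007e47700027032218854002100040900083,
  0x4000009643c0009541900018020000930200849249424412064240094000008f43c0008e42d0a400,
  0x44d0900002e2009f4710009e04e2747640d2700042f0000706414409400000994530009806409009,
  0x4ad2a8054ae200a94b72bca84c929c85000204074a500000461298a44d0000a34d2344a24620001b,
  0x204b440d1ec0044d1440002e2c8b14b3000b042f0007842f000264130001808d058ac03a2ac12,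
  0x42f0000e4bd0404c0be0a8bc04e2ec0c0c82e809400000b9453000b8413270000652d809400000b5,
  0xa409400000c742f000c642d0001806d040c4000084c34c53081800030409400000c042f000bf,
  0x4002bc00400000b442f000144cf0402c03a058ce0323341800933009400000cb42f000ca46600009,
  0x4973700c0c836c09400000da453000d94cf0404c08d058d704e3580c06435409400000d4453000d3,
  0x6102805420000e506d0406c020084e34973880c06438409400000e0453000df4ae0406c0de274dd]

/-- The automaton for the pieces of 4-day-old strings. -/
def table4 : ℕ := joinRows [
  0x6b0280006c0246c4000000800000007406000004c11b4054d7308040000015d1493600300000000,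
  0x6c0006c400000130000001241100000000000100140000f4000006b0000000d00c000000680380b,
  0x41e00000000074000200001c4000001501a0000f00006c1900c0600000005c6c4000001600013c15,
  0x200000001d0002700000026028094100000900006c08c6c4000002200000021000000080000001f,
  0x320002b0450c4000470c00006c0bc6c0001202e0000002d0000001d0000ac004000002a42c00029,
  0x470f0000000f43b0000003a400000330380002b0000e4370000d8000000d46c4000003400010033,
  0x46038000220000e44400010c0046c00042000000414000002e0000003f43e000000680640b,
  0x120504000002341e0004e42c000000470280004c12c000000004a04d124334000006c4000003b,
  0x1686b000000594580000004d1246c000158000571546c01a00054000190530001480046c00051,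
  0x5c2a43e0006306c0bc27000000610001886040017c0046b000000001785d0000005c0451105b,
  0xc01b805400000000000006c000168220000006a0690006c0450dc0004719c000001b06602000065,
  0x1d00078014000770791d81006b1d40006c1d06c40000073000000724710001d098000700990e46f,
  0x4710000001d00081032000800821fc100471f80006c1f46c0002187c0000007b47a0002942000000,
  0x380008c0002348b400228000002245d400000880932408706806405047214004000008442c00083,
  0x47258004000009541e000940471d40004c2486c0380009143e0600000023c8443e0008e06c0bc81,
  0x50990009f0002809e00c274000002706c4000009b4000009a41e0003301a0007707925c10,
  0x2a89a0a90009f0bf2a00b04729c0006c2986c400000a5000000a44a3000000002883b020000a1,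
  0xb412c27000000b30b72c8100002c4000572c06c099000af0002ecae0002b40046c000ac000120ab,
  0x472f8000000f4bd020000bc028094050002e800400000b94b5000b8000120a5000000b64b500000,
  0x6c2706c400000c7400000c64c50009f079320c44d630c004000002147a00083069000460bf2780b,
  0x400000d24d10000f028350d000c33c0006c3386c400000cd00013ccc4c10f00001d288ca0cb000c9,
  0x4dc00000126388db529000da53b4c0d94b50009a400000a401d07427020000d506c05c6c400000d3,
  0x47398814f10f4e51193e8e444738cae0a9000800c0384100473800006c37c6c400000de000000dd,
  0x690000d41100005099000ee01a280ed0ef3b00b0473ac6c400000ea400000e90e80c49f0f039c0b,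
  0x400000124f90f0000000f4f8014000f70683d83706b3d40006c3d06c400000f3400000f246900046,
  0x2a9044000003f000074100cb00101068400195023fc00400000724fd214000b43f8fc503000fb,
  0x4000010e0001010d4000000750b0f0000002890a10c001090454209e11841c0006c4186c40000105,
  0xc10f00001d0f5170000011606c0d46c40000114400001135120002b028455110004400006c43c6c,
  0x4000012242c0012141e0001251f000781200951e079474050474706c4000011b5240011a4000000d,
  0x6c4b06c4000012b4000012a000218a50000012852700000000218de0000012500c0601d00048c6c,
  0x400001360002a9354d60280004c4cd0a134001324004c400000288f80cb0012f0684b89e00c4b400,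
  0x1422a1400794fc050474f86c4000013d5240013c01d289170200013a0284e4c400c4e00006c4dc6c,
  0x55b0014a4110001001a0014801a06d470ef5180b0475146c400001444690014341e0000d14100078,
  0x4fd0f00001d289531340015241e000c6420000055500014f1545454e158534100475306c4000014b,
  0x15e000168730000015c0000ac6c4000015a47a001590ef5180504755c6c4000015647a00155,
  0xb429878]

/-- The automaton for the pieces of 5-day-old strings. -/
def table5 : ℕ := joinRows [
  0xa2028000a3024a30000000800000007406000004f3290051263d004000001cf1c149c0300000000,
  0xa3000a3000000130000001201100000000000100140000f000000a20000000d00c0000008b0380b,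
  0x1e081074a30000700008306c000840001a00021c19000060004a300017000000160000540d,
  0xf02800000027026000a308400000400000a20000002302200000025090210a20800008007c00,
  0x3243100000400000280000002f02e000000300002d0000002c0340ac000000a8000a30a4a3,
  0xa307ca30000003b0000003a43900000000000380000dc0040000036000000350a30240000000033,
  0x6a118000a2114000a31102d000000430001b042000104004a2000000001003f0000003e0000003d,
  0x140a34000004f0001504e0a2000000a3130a30000004b0000004a449000000000004804d00047,
  0x4000005a059000280001905800015c004a3000560000005500000030000000530000005200014400,
  0x400000a30630000000020062000000614000004e05f000470001805e00017400000170a34000005b,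
  0x1b8360000006d400000620000006b4000000d0690000f08b1a02106319c000000006600000065,
  0x7807a1dc100001d8000a31d4a3400000740000007300012000072000710001c0680221bc00,
  0x4390008207d000000a3110a30000007f0000007e00014c000000007c07d0007b0720000004800079,
  0x8c000a306a178000a22280000028c8902e000880001b8a3000000860000008540c0000040000075,
  0x63258000a3254790000009400026c93000248000002443f000000900641608f000238740000008d,
  0x2802402227c00000288000002789d07d0009c4a3000000000009a0002645a098000a206425c00,
  0xa22a8000a32a4a3400000a8000000a74a6000000e1368a540000000000000a30000c00002e000a1,
  0xb40b82cc100002c8000a32c4a30002fcb0000000af0ae000a3000054850ac0000f0ad2ac21,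
  0xbe4bd00000000000bc0002ec00400000ba07d000b9400000b0000000b70b600000005000b5,
  0xd03200006331c000a3318b5000000c5000348c400030c000003083f000000c1064160c0000000a8,
  0x40000066000000d10000000505f000cf000180ce00033400000330a3400000cb000150ca0c900047,
  0x5000dc05f000db000014000b6000d9400000850d70000f000360d6022354000003503607d000d3,
  0x238e6000000e50632ec00400000e30e4000e20a22c8000a3380a3400000df000000de4dd00000,
  0xa21d8000a33bca3400000ee000000ed4ec00000048000eb04d000ea0f03a4100a23a0000a339ca3,
  0x3e8a3400000f9400000f80f7000cf0343f4f65243d400400000b706314c00400000f207d000f1,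
  0x10400000103502000004000002f10000000030404ff0b6000fe069000cf0001c0fc0223ec00,
  0x1170010e00047d0d000430004a30010b0000010a0004244e1080004712341c0b0a2418000a3414a3,
  0x4000011807a1dc3800045800400001154390011410107c2d00000112113444a30004400008343ca3,
  0x634880000028d2102e0012047d00000000478620720011d0004705e02246c00000468a340000119,
  0x12c52b0000018f4c92a598001295b16a128406000234000007f0000012508c0006b12317821,
  0x634d8b542228d35169501340634cd0d0e4000b9014000b41314c0100a24bc000a34b8a34000012d,
  0x48c0006b011000300000013e0690013d08b4f0210634eca34000013a400001391383204713f4dc21,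
  0x8c000350140002c1495200b0a251c000a3518a340000145000001445430dc001015294215900141,
  0x22550000a354ca34000015200000151150000d9400000864000014e14d0000f02553d4c02252c00,
  0x6a578ce022574000a3570a34000015b0004255a005120b507200158400000121560000f0b855d55,
  0x7a1dd6800059c000a3598a340000165000151644000004b4000016256100000000479601630015f,
  0x400001721710ac784000003b0000016f56e000001745c16d0635b0a34000016b5760016a01100053,
  0x17c0000017f5f97b0a25e8000a35e4a30002fd78000001774000007c0e4001750000dca340000173,
  0x4d0018618c614000a2610000a360ca30000f18200000181180000b9084000b4400000130000017d,
  0x590000000630dc004000018e0000018d0a20a8000a362ca34000018a000001895880000003000187,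
  0x4000019a400001990ae0006b000424f819600047197654210a2650000a364ca30000019200000191,
  0xa3690a3400001a3000055a24000017d1a0000000004799f1a10019e0ad674ce022670000a366ca3,
  0xa36b8a3400001ad000425ac000120481ab001aa4006a40004812079072001a707a6995502269400,
  0x48c001b800c000101b741db608b6d4a50636d0a3400001b31ba001b2156000cf07a699b00226bc00,
  0x4ae001c207d000e204d000db1c06fc100a26f8000a36f4a30002fdbc000001bb063000a3400001b9,
  0x5479cc1ab001cb0a3140a3400001c9400001c81c7000471ce729c602271400063710a3400001c3,
  0x632a80011e74400000001d01ba000e2400000de5cd00000]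

/-- The automaton for the pieces of 6-day-old strings. -/
def table6 : ℕ := joinRows [
  0xe0028000e1024000000000800000007406000001663880517e5a004000002212105fc0300000000,
  0xe1000e1000000130000001201100000000000100140000f000000e00000000d00c000000dc0380b,
  0x1e0d007400000070000db06c000000001a00000019000060004e100017000000160000540d,
  0x400000e00000002702600000000094e10000002400000023022000000280840b0e0080000cf07c00,
  0x3243100000030000000000002f0000b8000000b4000e10b0e100031c2b0000002a029000e1,
  0xe1000000000003b0000003a039000000000003803c000370a60d80b0e00d4000000d00000000033,
  0x4608111400000110000db10c000970004200028841000100004e10003f0000003e0000f40d,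
  0x5b1400000013c000e1138e100018c4d0000004c04b000e10970000004a124250e01200006711c00,
  0xe0168000e1164000000005800000057456000004000002b00000054053000000550005200000051,
  0x640e107c000000006200000061060000000000005f000178004000005d0000005c0000000b,
  0x740006e07d1b4000e01b0000e11ace10000006a00000069068000004e0000000000006600000065,
  0x1e0000001dc00000000760001ec750e0000000e11cc000000007200000071070000000000006f,
  0x6000082400000e1080000004000007f0000007e4e1000000000007c000000300000007a00000079,
  0x8c0000008b0001e8000000008908a00088000000dc00000086087214100002100040000083,
  0x96000000950002500000024ce100000092000000910900000007d23c000e0238000e1234e1,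
  0x1bc000a00009f4000000d09d0000f0002789c02626c0000026800000000990000009800000005,
  0xaa0002a43b000000a80a7000e14000004d000000a50003848d0a4000a34000003b000000a1,
  0x1ecb40b3000e00bc2c8000802c4000002c0dc000000af000300ae0002b4000002b066000000ab,
  0xbe000000bd00019c7f000000bb400000750b90006e0002e8b80002dc000002d8e1400000b5,
  0xc800015400053000c60003142100c310000003800000030cc208a000c10dc2700b0e12fc00,
  0x400000d2000000d108a000000a4000000e1234ce000000cd000260cc00032c0000032866000000c9,
  0x40c000000000005500036800000000d9068000d80a00000006f000d6000000d50d73501000034c00,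
  0xe6000000e54e4000000f539ce340000000000000e10e134800000000df000000de0dd00000,
  0xf00d73bc100003b8000e13b4e1400000ec000000eb0ea000000f1000e9090000e80e107ce1,
  0x4fa00000000000f90803e000400000f7128000f60e10d000000000f4000000f34f2000000f1000d6,
  0x4102b00000103102000e10000f423100000371013fc0b0e03f8000e13f400000000fc000000fb,
  0x4000010e0000010d10c000000e14590b0000010a000489090004200000041c660000010600000105,
  0x11f4600008045c00460000000000011500045000400001130680011211114010000440000e143ce1,
  0x802fc0040000121000001200b9000960002e91e00047400000470e14000011b0001ed1a119000e0,
  0xe04b0000e14ace10000012a00000129400000231270000f0003152602649400000490c208a00123,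
  0x536000000000013500000134000001330004c8000004c4e1000001300001ed2f12e0006e07d4b400,
  0x500004e10013f0000013e0004f40d13c0000f1634ec0b0e04e8000e14e4000000013800000137,
  0x14a0000014d524250e05200015551c000000014615651400000510000db50c000970014200028941,
  0x15405b54c00000548000e1544e100031d500000014f14e000e1000268e10000014c0000014b,
  0x15e15d0000006f0015c0000015b15f56810000564004000015806000157128000000f100052,
  0x40000013400001670002a4df00000165164000e1000000f1000588000000016112800160400000df,
  0x172400001710e14e4e10000016f0000016e56d000000000016c1700016b0005d16a57c5a400,
  0x7d4b40b0e05ec000e15e8e10000017900000178577000000005d87f053001750264c8000005cce1,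
  0xe1618e14000018500000184583000001e965d825f2001816057f5804f20000d4000012a0000017d,
  0x740019019463c100e0638000e1634e10002a58c0000018b18a0011213c00154189620100e061c00,
  0x263859a1c7695990806614108036800400001960680019540000072000001931920000006f00191,
  0x1100005000001a309d001a20dc6840b080680e14000019f0000019e19d460001a46700008066d0b,
  0x1ae000c640000024400001ac1ab0000f14d6b5aa0266a400411380001556a1a71b5001a64000007e,
  0xe16e0e1400001b70004f5b60301bc000a0001b40006cc9c0266c8000e16c4e1400001b0000001af,
  0x1c2400001c10e1024e1000001bf000001be5bd00000000001bc1c0001bb07d70dba0266e400,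
  0x1d1141cc1d472c10080728e1400001c91db001c80e124ce1400001c6000001c51c4000bb0001dce1,
  0x1d61d500160000178e1400001d3400001d20e1348e1400001d0000001cf1ce0000006f001cd,
  0x1e1780100e077c000e1778e1000411dd000001dc12e00190194768100e0764000e1760e1000001d7,
  0x5ea000000300006f074001e807d79c000e0798000e1794e100031de4000001e31e20011202200154,
  0x1f4400001f30a70007e0000f52f1f00006e1f17bc0b0e07b8000e17b4e1000001ec000001eb,
  0x4007f8000e1094e1400001fc0000f5fb0001bc381fa001f909d0016b1017e1f70267d8000e17d4e1,
  0xe1820e140000207209002060004f5710e11cce100000203000002022010000000000200204001ff,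
  0x4000021261f002110f1001910740020f194838100e0834000e1830e10004120b0000020a0e07b855,
  0xe00b4000e186ce14000021a0000021921800000055002172040021621c854100268500008084ce1,
  0x1634ec250808900000088c0000000222000410ec00000220080450004000021e2090021d]

/-- The automaton for the pieces of 7-day-old strings. -/
def table7 : ℕ := joinRows [
  0xa000000094080000016f58c074000000017a018051d15ec040000025624e7480300000000,
  0x5005000000130000001201100000000001620000000f00e000000170400d1620300000502c05,
  0x1e000074000000700000506c0000057c1a0000001901800005400001620000001601500000,
  0x28000000000002702b000261320940d1620900000008c0000000022000000214200000001f00000,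
  0x1310c80000000031000000300000bc004000002e0000002d0000b00f005000000000002a00000029,
  0xf0000000003b0000003a039000000480e0140000dc001140d8000000003511e0d0000000cc00,
  0x16200000005114000000004400000043042000000001040004600040005000260000fc3e1620f400,
  0x101000500000004f10713800000134000051300500057c4b0000004a049000054000002a00000047,
  0x5a459000000580000000000057000158000001540000015000400000530000005205100000,
  0x1946400000063000000620001842a0000006005f0000505e0940d00017400000170000000005b,
  0x1b8000001b4000000006c0000006b06a000000001f46900000068000260670001980056200000,
  0x7807a00077046000000410007500000074005000050000007200000071070000000761cc6f,
  0x8200058881080000000901fc000971f800000114050000007c0000007b000001010001e400,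
  0x8c00022c000002280000000089400000880000004108700086000238850002100000020c05,
  0x6f096000950692500d00524c000000009200000091000450000000008f000000580000008d,
  0xa00000009f09e000000002741000e270000005880000026c9a0da00099400000054000000f,
  0x1622a8000002a400000000a8000000a74a6000000a500000000000a400028c000002880000528400,
  0xb40002cc000002c864000000b1000000b00002bc2a000000ae0ad0000509a000260ac2ac0d,
  0x334be0002f4000002f005000000bb000000ba0b9000000d02e0000972dc000002d800000000b5,
  0xc84c700000000000c6000000c5000000c400030c0000030800000000c1400000c00bf00086,
  0xd2000000d107a0000000033c2a000000ce000000260003300d16232c0000032800000000c9,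
  0xdc000000db0002540000536400000000d8000000d70d600000096000260d53500d00534c00,
  0xe6000000e50003900000038c05000000e2000000e10e0000000fe37c001623780000537405,
  0xf00003bc0f0ee000260d53b40d1623b0000003ac00000000ea000000e90e800000000000e7,
  0x1623e8000fb3e400000000f80fc3dc000003d8001313d400000000f4000000f30003c800405000f1,
  0x10400000103102000000970000040000100000000ff0000006d000000fd0da0000009d0400d,
  0x10e0000010d10c000000000010b0004280040000109000001080000000d1624180000041400,
  0x4600000000117000001161150000000057c5300000113112000051110400d1624400000543c00,
  0x12448827000484004000012012e0011f405000000000011d000470c011b000860464680016246400,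
  0x12c000001624ac000054a8050000012900000128000314000000012612700125000000d500000123,
  0x1360004d42a000001341330000540e000000053e400000001300000012f000001000000012d,
  0x5894013f000001574f8000974f4000004f0690000013b0002613a0004e4000004e06400000137,
  0x14a00052400000520000000014740000146145000860005454400050c000005080500000141,
  0x1540000000054c2a0000015216217400000540000000014f0000014e54d000000000014c0000014b,
  0x15e0000015d15c0000015b2500d005568000000015900000158000460050000015600000155,
  0x40000168000001671660000016b0016500000164000000050000006400000161000001600051b400,
  0x5c800400001711270017000508c000000016e0000016d56c000000000746f0005a8000055a400,
  0x1ce5f00040000047011000260175e40d1625e0000055dc0000000176000001755740000000000173,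
  0x6180500000185400001840053ac000000018200000181580000000000017f1830017e0007197d,
  0x1c36400d16263c00000638000000018d0000018c58b000000000018a000001890000018801561c00,
  0x1ba66800000664001316600000000197000001960006540040500194000001930006480f19100026,
  0x1a4000050150f40000068805000001a1000001a019f000001a367814162674001ab670000000019b,
  0x1ae000001ad1ac000000a500050000001aa1076a4000006a00000569c0500057da6000001a5,
  0x1b8000001b70006d8000006d405000001b4000471b31b2000860fe6c4001626c0000056bc05,
  0x1c21c100000041001c0000001bf1246f86f0006f400400001bc12e001bb4e800000000001b9,
  0x573005000001cb000001ca1c9000000007210009e001c7000184d8000001c51c400005400000d8,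
  0x5d60000022b78dd5636001d4647905d34a60000f00511405400001d0000001cf0fe4680016273400,
  0x1e0400000781df001de16b00075191001dc1dd76c6f1627680000576400400001d8000001d7,
  0x157a800070588001ab7a5e81f6001e70150013b204799e5097791961622540000578805000185e1,
  0x7d03e0157cc000057c805000001f1000001f01ef0000040000013000001ed1ec000001a37b9eb,
  0x1fe000000007f42a201001fc0fe7ed440157e8000057e405000001f8000649f70a510400046001f5,
  0x20e8206f00581c00400002062170020500538c0540000203000002020054600500000200000001ff,
  0x584805000002110000021020f00125005364054000020d0000020c20b000000410020a09600209,
  0x2268706f16286c00005868050004d619000002180971e4000000021607a002152141cc6f16284c00,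
  0x52a40000000225000002246230000000515000400002210000022021f000002220021e0110021d,
  0x1628c0000058bc050000022e0000022d62c00000162288000058a805000002290000022822700108,
  0x1628e8000058e4050000023840000237133000ff4050002e000002340008cdb3232000862358c40d,
  0x64a4424300086400908000001841a0000024023f000050000b01223d0002600e000c523e8f23b,
  0x4d5680000024d12c0000d16292c00005928054000024924c002480156d8000009180500000245,
  0x9600000000257000185680000025524c000ff2539086f0159480009794405400002506540024f,
  0x2b000951329681400096400]

/-- The automaton for the pieces of 8-day-old strings. -/
def table8 : ℕ := joinRows [
  0xa000000090080000014804407400000001520180517d54c040000022c21d5f80300000000,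
  0x1400000143000130000001200000005000000100000000f00e000000000000d0100300000502c05,
  0x1e005000050000001c0000001b01a00000000074190000600000505c004000001600000015,
  0x28000000000002702b000261200940d0000900000008c0000000022000000214200000001f00000,
  0x11f0c80000000031000000300000bc004000002e0000002d0000b00f005000000000002a00000029,
  0x3c00000400000100000003a0390000004b0ec380000dc000c20d800000000350d80d0000000cc00,
  0x460450000000011000049000430050002600010841010100000000fc000000003e0000003d,
  0x1400000513c000000384e0000004d04c000004000002a0000004a010000000051200000000047,
  0x5a000164000001600000015c004000005600000055054000000a700053000000520ab14400,
  0x1902a0000006306200005061094000001800000017c000000005e0000005d45c0000005b00000,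
  0x6e000000911b4000a61b0000001ac000000006a000000690001a00000019c050000006600000065,
  0x780000007707600000000000750790007400021c730001c8000001c405000000700000406f,
  0x8248100000000000800000007f0000007e0001f4000001f0000000007b4000007a00012000,
  0x8c0000008b08a000000002240000000088000000260102180d000214000002100000000083,
  0x17d0009609725400005250000000009300000092000000440000009000023c000102380000023400,
  0xa3000a0075000480000009e09f2740d0002700000026c000000009a000000990980000000000019,
  0xaa000000a90a8000004000000500012005000000a5000000a4000000a700028800000000a1,
  0x2d0000002cc00000000b2000000b10b000000000000af0002b800000000ad000000ac00002c00,
  0x8000000000000bd0002f0000002ec000002e8000002f8b9000000b80b7000050a3000000b62d40d,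
  0x493200000031c0000031800000000c5000000c40c30000041000000000000c1000000c0000000bf,
  0xd20d100000000000d0000000cf000000ce0003340000033000000000cb000358ca0c900090,
  0xe33702700036c00400000da0ec000d940500000000000d70002180d0003540000035000000000d3,
  0xe6000000e50e4000000002580000538800000000e1000000e00df00000000000de000000dd,
  0x103c0000053bc00000000ee000000ed0a600000000000eb000000ea0e9000000103a00000039c00,
  0x3e8000053e400000000f8000000f70f6000000000e005000000f4000000f30f2000000f53c40d,
  0x1040002610540c0d000408000004040000000100000000ff0fe000000fd00000000000fc0003ec00,
  0x10e0000010d0004300000042cc10000010a000001090004202a000001071060000500004000,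
  0x1180009000046517000458000004540000000114000001131120000011b444000a64400000043c00,
  0x1221210000540e000000de1040d005478000000011d0000011c0002d42a0000011a400000ca,
  0x1394b0000a64ac000004a800000001290000012800049c00000498c1000001250000012400048c2a,
  0x136000000004d42a00000134079000900004cd320004c4000004c0050000012f0000412e12d00000,
  0x1400000013f13e0000013d2540d0054f0000000013b0000013a000234050000013800000137,
  0x4000014a0e4001490104080000051c0000000146000001455440000009f274190005080000550400,
  0x17b550004000004a0b63c40d01054400005540000000014f0000014e14d000000000014c00052c00,
  0x15e000260de5740d0105700000556c000000015a000001595580000000000157165001560005cd55,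
  0x5a005000001674000016611f00000000001640000016300058800400001610000016000057c0f,
  0x1725740d0105c4000005c0000000016f0000016e56d000000000016c0000016b0000016a0005a400,
  0x17c0e923c000105e8000005e4050000017800000177176000000005d4eb000001740df00005,
  0x1061800005614004000018400000183582000001ec631815fa0018021080d7f4000000f400000a5,
  0x6400011f63c000000018e0a66cd8d000190e10000018b18a000050800002702b0018818961c0d,
  0x66800005664000000399800000197196000001950ec38000650000c264c00000001920d864400,
  0x1a400068c000006880000068400400001a00000019f19e000000a70019d0000019c1ab66c00,
  0x6b800400001ad000001ac0610940d0006a8000006a400000001a8000001a75a6000001a500000,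
  0x709b80c264c191b7001b6039001291c66d5b40052cc00000001b2000001b11b000000000001af,
  0x523405000001c1000001c01bf000000006f82a049001bd0006f1320106ec000006e805000001b9,
  0x1cc17d001cb1d07281900572400400001c81d9001c70000018d00071400405001c4000001c3,
  0x1d6274190107540000575000000001d3000001d21d10000000538805000001cf000001ce1cd00000,
  0x1e8001e00f20019c1df77819010774000057700000048ddb000001da0a628800000001d80a3001d7,
  0x1ea000001e90102d00000579c00000001e6000001e51e400000000001e300078800400001e1,
  0x7d9f41f3000901f87c80d0107c4000007c005000001ef000001ee5ed000000103e8000057ac05,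
  0x107f8000057f405000001fc400001fb400000eb121001f94050002e000001f700033005000001f5,
  0x820050000020700070a0620500090400810000000e0000000020200000201200000260007fc0d,
  0x400002122150021100056c000000020f0000020e20d000000000020c0000020b0000020a03982400,
  0x21c000000000021b00086819000864000058600000048e17000002160e90000d0108500000584c05,
  0x400001c400000225000890f32230009022688819039884000a6880054000021f6270021e4fe00000,
  0x618c0000008bc000008b8000000022d00019cc10000022b0000022a0008a6170000022821500005,
  0x8900f23100096]

/-- The automaton for the pieces of 9-day-old strings. -/
def table9 : ℕ := joinRows [
  0x100281000000009000000080070000003c0440604d0140008e13c04000001a118a23c0300000000,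
  0x1400000034000130000001240000000000000100000000f0000000e00d000000000000c00002c00,
  0x1e0000001d41c0000001b000000000001a000064000000600001005c004000001600000015,
  0x3c0e0100000000000026000000250240000000000023027000220280840c0000800000007c00,
  0xc80000000031000000300000bc000000b8100000002d0000002c0000ac260000002a02900010,
  0x3c0003b000220280e80c00f0e4000000e0000000003700000036435000004000001003300000,
  0xf1180c0001140001011000000000430000004204100000000000400000fc004000003e0000003d,
  0x8b14000400000260000004e4000000f0000004c04b0000000012800000000490000004804700000,
  0x220001640c00f1600001015c000000005600000055054000000000005305a000520001e851,
  0x64000000630620000000000061000000600000005f00017800000174100000005c4000005b,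
  0x6e0000006d0001b0004000006b0000006a0001a40e0680002207019c0c00f1980000019400,
  0x7807700000000000760001d4000101d00000000073000000720710000040d0000006f00000,
  0x892080000f20400000200100000007f0000007e07d000000001f0320000007b0100001000000079,
  0x8c000000320000008a00f00000010220000000008700000086085000000000008400000083,
  0x10258004000009500000094493000001292709255e00091179590904000000e000220104000008d,
  0x2800006f27c000000009e0333509d0001d0000000009b0000009a099000100981640c00f25c00,
  0xf2a8000002a400000000a8000000a70a6000000ae2944a0002900000028c00000000a200028400,
  0xca2d0000002cc000102c800000034b1000000b00af000000002100004d000ad010000220002b0ab,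
  0xbe00000000000bd0002f0000002ec000002e800400000b9000000b80b7000000c5000b6000000b5,
  0xc8000000c70c60000000d0002200f3100000030c0000030800000000c1000000c04bf00000,
  0x1034800000000d1000000d00cf00000000000ce00033400400000cc000000cb00f02c0000032400,
  0xdc00003cdb0da000000ed364000333600000035c0004b000d6112400d500f0000c00034c00,
  0xe600022000000000e4000000e30e200000000000e1010000e0000394df0003780000037410,
  0x103c000000000ef000000ee0002080000f3b0000003ac00000000ea000000e90e80000000039c00,
  0xe100088000000f90fa3e00c0003dc000003d800000000f5000000f40f300000010000750f23c400,
  0x1040004390300028c76102001010000008d000000ff000000c50003f400000000fc0fe000fb,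
  0x103ac000000010d0000010c10b000000004280004d00109010000830004210700f4180000041410,
  0x4600001045c000004891600000115400000ef114001130000009d00044400400001100000010f,
  0xf34c0001048400000001200000011f11e000000000011d000470004000011b0fe0011a1192d00c,
  0x12c0000012b52a00000000000d60000012800049c0040f00000000499250000012400000123,
  0x136000001350004d00040000133000001320004c40e130000221574bc0c00f4b8000004b410,
  0x1400000013f13e000001434f44a0004f0000004ec000000013a0004e4000004e0000104dc00,
  0x14a14f524000005200001051c000000354600000145144000000002b02600f5080000050400,
  0x1540000000000153000548000000015100000150000028000000014e0000014d14c0000014b000b6,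
  0x498100000015d0000015c00056c260000015a4000003215900158000348000000015600000155,
  0x1680005dd6716600083400594000470002200058c0c00f5880001058410000001604000015f,
  0xf5c8000005c400000001700000016f16e000000000016d0000016c0000016b04b5a8000005a410,
  0x105f0104000017b17e0017a41000110000001780100280000000176000001751740000017319c0c,
  0x18600000185000000000018400060c760006080001060400000489800000017f0890000c00f5f400,
  0x1900008319163c7604b63800033634104000018c5940018b0000e400000624000000018800000187,
  0x19a000664760006600001065c00000489960000019500056c7300000193192000100004380e,
  0x6900000068c00000001a200f164000006800000067c000000019e0000019d19c0000019b00000,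
  0x15900010130000001a669400]

/-- The number `1000` is fuel: it bounds the number of product nodes that the search may process,
here and in the following checks. -/
theorem check2 : baseSource.check table2 1000 = true := by decide +kernel

theorem check3 : (tableSource table2).check table3 1000 = true := by decide +kernel

theorem check4 : (tableSource table3).check table4 1000 = true := by decide +kernel

theorem check5 : (tableSource table4).check table5 1000 = true := by decide +kernel

theorem check6 : (tableSource table5).check table6 1000 = true := by decide +kernel

theorem check7 : (tableSource table6).check table7 1000 = true := by decide +kernel

theorem check8 : (tableSource table7).check table8 1000 = true := by decide +kernel

theorem check9 : (tableSource table8).check table9 1000 = true := by decide +kernel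

/-! ### Recognizing splittings -/

theorem JHC_cons_of_notMem {x : ℤ} {v : List ℤ} (h : x ∉ v.head?) :
    JHC (x :: v) = 1 :: x :: JHC v := by
  simpa using JHC_run (m := 1) (by simp) h

/-- A class of strings that is closed under `JHC` and whose members do not begin with `2`. -/
inductive AvoidsTwo : List ℤ → Prop
  | one_cons {x : ℤ} {t : List ℤ} : x ≠ 1 → x ∉ t.head? → AvoidsTwo (1 :: x :: t)
  | ones_append {t : List ℤ} : 1 ∉ t.head? → AvoidsTwo (1 :: 1 :: 1 :: t)
  | three_cons {v : List ℤ} : 3 ∉ v.head? → 3 ∉ (JHC v).head? → AvoidsTwo (3 :: v)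
  | singleton {x : ℤ} : x ≠ 1 → x ≠ 2 → AvoidsTwo [x]

/-- The classes are permuted in a cycle: `1 x ...` becomes `1 1 1 x ...`, then `3 1 ...`, then `1 3
...`. The side conditions are what is needed to stay on this cycle, and a single letter enters it at
`1 x`. -/
theorem AvoidsTwo.JHC {w : List ℤ} (h : AvoidsTwo w) : AvoidsTwo (JHC w) := by
  cases h with
  | @one_cons x t hx ht =>
    rw [JHC_cons_of_notMem (by simpa using hx), JHC_cons_of_notMem ht]
    exact .ones_append (by simpa using hx)
  | @ones_append t ht =>
    have h1 := JHC_run (m := 3) (by simp) ht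
    have h2 : _root_.JHC (1 :: 1 :: 1 :: t) = 3 :: 1 :: _root_.JHC t := by
      simpa [List.replicate_succ] using h1
    rw [h2]
    refine .three_cons (by simp) ?_
    cases t with
    | nil => simp [JHC_nil, JHC_cons, pushLetter]
    | cons y t =>
      obtain ⟨m, s, hs⟩ := exists_JHC_cons y t
      rw [hs]
      -- The new string is `3 1 m y ...` with `y` different from `1`, so the run of ones after the
      -- `3` has length `1` or `2`. Its count is not `3`, as `three_cons` demands.
      have hy : 1 ∉ (y :: s).head? := by simpa using ht
      by_cases hm : m = 1
      · subst hm
        have := JHC_run (m := 2) (by simp) hy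
        simp only [List.replicate_succ, List.replicate_zero, List.cons_append,
          List.nil_append] at this
        rw [this]
        simp
      · rw [JHC_cons_of_notMem (by simpa using hm)]
        simp
  | @three_cons v hv hv' =>
    rw [JHC_cons_of_notMem hv]
    exact .one_cons (by norm_num) hv'
  | @singleton x h1 h2 =>
    rw [JHC_cons_of_notMem (by simp), JHC_nil]
    exact .one_cons h1 (by simp)

theorem AvoidsTwo.iterate {w : List ℤ} (h : AvoidsTwo w) (n : ℕ) :
    AvoidsTwo (_root_.JHC^[n] w) := by
  induction n with
  | zero => exact h
  | succ n ih => rw [Function.iterate_succ_apply']; exact ih.JHC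

theorem AvoidsTwo.two_notMem_head? {w : List ℤ} (h : AvoidsTwo w) : 2 ∉ w.head? := by
  cases h with
  | singleton h1 h2 => simpa [eq_comm] using h2
  | _ => simp

/-- Strings that begin with a run of two letters `2`, followed by nothing or a string in
`AvoidsTwo`, always begin with `2`. -/
theorem head?_iterate_two_two {v : List ℤ} (h : v = [] ∨ AvoidsTwo v) (n : ℕ) :
    (JHC^[n] (2 :: 2 :: v)).head? = some 2 := by
  suffices ∃ u : List ℤ, (u = [] ∨ AvoidsTwo u) ∧ JHC^[n] (2 :: 2 :: v) = 2 :: 2 :: u by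
    obtain ⟨u, -, hu⟩ := this
    rw [hu, List.head?_cons]
  induction n with
  | zero => exact ⟨v, h, rfl⟩
  | succ n ih =>
    obtain ⟨u, hu, he⟩ := ih
    refine ⟨JHC u, ?_, ?_⟩
    · rcases hu with rfl | hu
      · exact .inl JHC_nil
      · exact .inr hu.JHC
    · rw [Function.iterate_succ_apply', he]
      refine JHC_run (m := 2) (by simp) (c := 2) (v := u) ?_
      rcases hu with rfl | hu
      · simp
      · exact hu.two_notMem_head?

/-- No four consecutive letters of a look-and-say string agree. -/
theorem JHC_ne_replicate_append (w : List ℤ) (x : ℤ) (k : ℕ) (v : List ℤ) :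
    JHC w ≠ List.replicate (k + 4) x ++ v := by
  intro h
  cases w with
  | nil => simp [JHC_nil, List.replicate_succ] at h
  | cons y w =>
    obtain ⟨m, u, hu, hyu⟩ := exists_run y w
    rw [hu, JHC_run (by simp) hyu] at h
    cases u with
    | nil => simp [JHC_nil, List.replicate_succ] at h
    | cons z u =>
      -- The second and the fourth letter are the values of neighbouring runs, hence different.
      obtain ⟨b, t, ht⟩ := exists_JHC_cons z u
      simp [ht, List.replicate_succ] at h
      simp at hyu
      omega

theorem exists_JHC_eq_run {w : List ℤ} (h : w ≠ []) : ∃ (m : ℕ) (x : ℤ) (v : List ℤ),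
    w = List.replicate (m + 1) x ++ v ∧ x ∉ v.head? ∧ JHC w = ((m + 1 : ℕ) : ℤ) :: x :: JHC v := by
  obtain ⟨x, w, rfl⟩ := List.exists_cons_of_ne_nil h
  obtain ⟨m, v, h1, h2⟩ := exists_run x w
  exact ⟨m, x, v, h1, h2, by rw [h1, JHC_run (by simp) h2]⟩

/-- The first letter is the length of the first run of a look-and-say string, which cannot begin
with four equal letters. -/
theorem head?_JHC_JHC {w : List ℤ} {x : ℤ} (h : x ∈ (JHC (JHC w)).head?) :
    x = 1 ∨ x = 2 ∨ x = 3 := by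
  rcases eq_or_ne w [] with rfl | hw
  · simp [JHC_nil] at h
  obtain ⟨m, y, v, h1, -, h3⟩ := exists_JHC_eq_run (JHC_ne_nil hw)
  rw [h3] at h
  simp only [List.head?_cons, Option.mem_def, Option.some.injEq] at h
  have : ¬ 3 ≤ m := by
    intro hm
    obtain ⟨k, rfl⟩ := Nat.exists_eq_add_of_le' hm
    exact JHC_ne_replicate_append w y k v h1
  omega

/-! ### Coding integers by symbols -/

/-- The symbol for an integer. -/
def code (x : ℤ) : Letter :=
  if x = 1 then one else if x = 2 then two else if x = 3 then three else other

@[simp] theorem code_one : code 1 = one := rfl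
@[simp] theorem code_two : code 2 = two := rfl
@[simp] theorem code_three : code 3 = three := rfl

theorem code_eq_one {x : ℤ} : code x = one ↔ x = 1 := by
  unfold code; split_ifs <;> simp_all

theorem code_eq_two {x : ℤ} : code x = two ↔ x = 2 := by
  unfold code; split_ifs <;> simp_all

theorem code_eq_three {x : ℤ} : code x = three ↔ x = 3 := by
  unfold code; split_ifs <;> simp_all

theorem code_eq_other {x : ℤ} : code x = other ↔ x ≠ 1 ∧ x ≠ 2 ∧ x ≠ 3 := by
  unfold code; split_ifs <;> simp_all

/-- Equality of symbols decides equality of letters unless both are `other`. This is why `other` is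
tolerated only at the end of a piece. -/
theorem eq_of_code_eq {x y : ℤ} (h : code x = code y) (hx : code x ≠ other) : x = y := by
  cases hc : code x with
  | one => exact (code_eq_one.1 hc).trans (code_eq_one.1 (h ▸ hc)).symm
  | two => exact (code_eq_two.1 hc).trans (code_eq_two.1 (h ▸ hc)).symm
  | three => exact (code_eq_three.1 hc).trans (code_eq_three.1 (h ▸ hc)).symm
  | other => exact absurd hc hx

@[simp] theorem Letter.beq_iff {x y : Letter} : x.beq y = true ↔ x = y := by
  cases x <;> cases y <;> simp [Letter.beq]

@[simp] theorem Letter.beq_eq_false {x y : Letter} : x.beq y = false ↔ x ≠ y := by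
  cases x <;> cases y <;> simp [Letter.beq]

theorem code_natCast_succ (k : ℕ) : code ((k + 1 + 1 : ℕ) : ℤ) = (code ((k + 1 : ℕ) : ℤ)).succ := by
  rcases k with _ | _ | _ | k
  · rfl
  · rfl
  · rfl
  · have h1 : code ((k + 3 + 1 : ℕ) : ℤ) = other := code_eq_other.2 (by omega)
    have h2 : code ((k + 3 + 1 + 1 : ℕ) : ℤ) = other := code_eq_other.2 (by omega)
    rw [h1, h2]
    rfl

/-- Only the last letter may differ from `1`, `2`, `3`. -/
def OtherLast : List ℤ → Prop
  | [] => True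
  | x :: w => (code x = other → w = []) ∧ OtherLast w

/-- The symbol for the length of the first run. -/
def firstCount (w : List ℤ) : Letter :=
  match JHC w with
  | [] => other
  | m :: _ => code m

/-- Each positive case of `Head.avoidsTwo` is one constructor of `AvoidsTwo`. The value `other` of
`firstCount` for an empty rest makes `1` alone fail and `3` alone pass; `ho` turns the case of a
letter `other` into a single letter. -/
theorem avoidsTwo_of_head {x : ℤ} {k : ℕ} {v : List ℤ} (hv : x ∉ v.head?)
    (ho : code x = other → k = 0 ∧ v = [])
    (h : Head.avoidsTwo (code x) (code ((k + 1 : ℕ) : ℤ)) (firstCount v) = true) :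
    AvoidsTwo (List.replicate (k + 1) x ++ v) := by
  cases hx : code x with
  | one =>
    obtain rfl := code_eq_one.1 hx
    rw [hx] at h
    cases hk : code ((k + 1 : ℕ) : ℤ) with
    | one =>
      have hk := code_eq_one.1 hk
      obtain rfl : k = 0 := by omega
      have h : firstCount v = one := by simpa [Head.avoidsTwo] using h
      rcases eq_or_ne v [] with rfl | hv0
      · simp [firstCount, JHC_nil] at h
      · obtain ⟨m, y, t, rfl, hy, hJ⟩ := exists_JHC_eq_run hv0
        rw [firstCount, hJ] at h
        have := code_eq_one.1 h
        obtain rfl : m = 0 := by omega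
        exact .one_cons (by simpa [eq_comm] using hv) hy
    | two => rw [hk] at h; simp [Head.avoidsTwo] at h
    | three =>
      have hk := code_eq_three.1 hk
      obtain rfl : k = 2 := by omega
      exact .ones_append hv
    | other => rw [hk] at h; simp [Head.avoidsTwo] at h
  | two => simp [hx, Head.avoidsTwo] at h
  | three =>
    obtain rfl := code_eq_three.1 hx
    rw [hx] at h
    cases hk : code ((k + 1 : ℕ) : ℤ) with
    | one =>
      have hk' := code_eq_one.1 hk
      obtain rfl : k = 0 := by omega
      have h : firstCount v ≠ three := by
        rw [hk] at h
        simpa [Head.avoidsTwo] using h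
      refine .three_cons hv fun h3 => h ?_
      rw [firstCount]
      cases hJ : JHC v with
      | nil => simp [hJ] at h3
      | cons a s => simp_all
    | two => rw [hk] at h; simp [Head.avoidsTwo] at h
    | three => rw [hk] at h; simp [Head.avoidsTwo] at h
    | other => rw [hk] at h; simp [Head.avoidsTwo] at h
  | other =>
    obtain ⟨rfl, rfl⟩ := ho hx
    have := code_eq_other.1 hx
    exact .singleton this.1 this.2.1

/-- What `headOf` says about a string. -/
theorem headOf_spec {w : List ℤ} (hw : w ≠ []) (ho : OtherLast w) :
    ∃ (x : ℤ) (k : ℕ) (v : List ℤ) (b : Bool), w = List.replicate (k + 1) x ++ v ∧ x ∉ v.head? ∧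
      (code x = other → k = 0 ∧ v = []) ∧
      headOf (w.map code) = .run (code x) (code ((k + 1 : ℕ) : ℤ)) (firstCount v) b ∧
      (b = true → v = [] ∨ AvoidsTwo v) := by
  induction w with
  | nil => exact absurd rfl hw
  | cons y w ih =>
    rcases eq_or_ne w [] with rfl | hw0
    · refine ⟨y, 0, [], true, by simp, by simp, by simp, ?_, by simp⟩
      simp [headOf, Head.push, firstCount, JHC_nil]
    · obtain ⟨x, k, v, b, hw', hx, hox, hh, hb⟩ := ih hw0 ho.2
      have hy : code y ≠ other := fun h => hw0 (ho.1 h)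
      by_cases hxy : y = x
      · subst hxy
        refine ⟨y, k + 1, v, b, ?_, hx, fun h => absurd h hy, ?_, hb⟩
        · rw [hw', List.replicate_succ (n := k + 1), List.cons_append]
        · have : headOf ((y :: w).map code) = (headOf (w.map code)).push (code y) := rfl
          rw [this, hh, Head.push, Letter.beq_iff.2 rfl, code_natCast_succ]
          rfl
      · have hc : (code y).beq (code x) = false := by
          rw [Letter.beq_eq_false]
          exact fun h => hxy (eq_of_code_eq h hy)
        refine ⟨y, 0, w, Head.avoidsTwo (code x) (code ((k + 1 : ℕ) : ℤ)) (firstCount v), by simp,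
          ?_, fun h => absurd h hy, ?_, fun h => .inr ?_⟩
        · rw [hw']
          simpa [List.replicate_succ, eq_comm] using hxy
        · have : headOf ((y :: w).map code) = (headOf (w.map code)).push (code y) := rfl
          rw [this, hh, Head.push, hc]
          have hf : firstCount w = code ((k + 1 : ℕ) : ℤ) := by
            rw [firstCount, hw', JHC_run (by simp) hx]
          rw [hf]
          rfl
        · rw [hw']
          exact avoidsTwo_of_head hx hox h

/-- Recognized splittings are splittings. -/
theorem separated_of_splits {x : ℤ} {w : List ℤ} (ho : OtherLast w)
    (h : (headOf (w.map code)).splits (code x) = true) (n : ℕ) : x ∉ (JHC^[n] w).head? := by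
  rcases eq_or_ne w [] with rfl | hw
  · simp [iterate_JHC_nil]
  obtain ⟨y, k, v, b, hw', hy, hoy, hh, hb⟩ := headOf_spec hw ho
  rw [hh] at h
  -- The cases of the letters `1` and `3` share this argument: the right-hand part keeps the form `2
  -- 2 u` forever.
  have htwo : code x ≠ two → code y = two ∧ code ((k + 1 : ℕ) : ℤ) = two ∧ b = true →
      x ∉ (JHC^[n] w).head? := by
    rintro hx ⟨h1, h2, h3⟩
    obtain rfl := code_eq_two.1 h1
    have := code_eq_two.1 h2
    obtain rfl : k = 1 := by omega
    have : w = 2 :: 2 :: v := by simpa [List.replicate_succ] using hw'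
    rw [this, head?_iterate_two_two (hb h3)]
    intro h
    exact hx (code_eq_two.2 (by simpa using h.symm))
  cases hx : code x with
  | one =>
    rw [hx] at h
    exact htwo (by simp [hx]) (by simpa [Head.splits, and_assoc] using h)
  | three =>
    rw [hx] at h
    exact htwo (by simp [hx]) (by simpa [Head.splits, and_assoc] using h)
  | two =>
    obtain rfl := code_eq_two.1 hx
    rw [hw']
    exact ((avoidsTwo_of_head hy hoy h).iterate n).two_notMem_head?
  | other =>
    rw [hx] at h
    have h : code y ≠ other ∧ code ((k + 1 : ℕ) : ℤ) ≠ other := by simpa [Head.splits] using h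
    have hx := code_eq_other.1 hx
    intro hxn
    -- The data exclude the first letter on day `0` and the first count on day `1`; from day `2` on
    -- the first letter is `1`, `2` or `3`.
    match n with
    | 0 =>
      rw [Function.iterate_zero, id, hw'] at hxn
      obtain rfl : y = x := by simpa [List.replicate_succ] using hxn
      exact h.1 (code_eq_other.2 hx)
    | 1 =>
      rw [Function.iterate_one, hw', JHC_run (by simp) hy] at hxn
      obtain rfl : ((k + 1 : ℕ) : ℤ) = x := by simpa using hxn
      exact h.2 (code_eq_other.2 hx)
    | n + 2 =>
      rw [Function.iterate_succ_apply', Function.iterate_succ_apply'] at hxn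
      have := head?_JHC_JHC hxn
      tauto

/-! ### Soundness of the search -/

/-- Reading a string from right to left, the automaton arrives in the state `q` without passing
through the dead state. -/
inductive Reads (T : ℕ) : List Letter → ℕ → Prop
  | nil : Reads T [] 1
  | cons {x : Letter} {w : List Letter} {q : ℕ} :
      Reads T w q → next T q x ≠ 0 → Reads T (x :: w) (next T q x)

/-- Strings accepted by an automaton. -/
def IsPiece (T : ℕ) (a : List ℤ) : Prop :=
  OtherLast a ∧ ∃ q, Reads T (a.map code) q ∧ accepting T q = true

/-- `u` is cut into pieces; all but the leftmost one are accepted, and that one leads to the state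
`q` and has the beginning `t`. -/
def Chopped (T : ℕ) (u : List ℤ) (q : ℕ) (t : Head) : Prop :=
  ∃ (r : List ℤ) (l : List (List ℤ)), r ++ l.flatten = u ∧
    ((r = [] ∧ l = []) ∨ SepChain (r :: l)) ∧ (∀ a ∈ l, IsPiece T a) ∧ OtherLast r ∧
    Reads T (r.map code) q ∧ headOf (r.map code) = t

/-- The relation computed by `feed`. -/
def FeedsTo (T q : ℕ) (t : Head) (x : Letter) (q' : ℕ) (t' : Head) : Prop :=
  q' ≠ 0 ∧
    ((t.splits x = true ∧ accepting T q = true ∧ q' = next T 1 x ∧ t' = .run x one other true) ∨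
    (t.splits x = false ∧ (x = other → t = .empty) ∧ q' = next T q x ∧ t' = t.push x))

@[simp] theorem forceNat_eq {α : Type} (n : ℕ) (f : ℕ → α) : forceNat n f = f n := by
  cases n <;> rfl

@[simp] theorem forceLetter_eq {α : Type} (x : Letter) (f : Letter → α) :
    forceLetter x f = f x := by
  cases x <;> rfl

@[simp] theorem forceBool_eq {α : Type} (b : Bool) (f : Bool → α) : forceBool b f = f b := by
  cases b <;> rfl

@[simp] theorem forceHead_eq {α : Type} (t : Head) (f : Head → α) : forceHead t f = f t := by
  cases t <;> simp [forceHead]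

theorem Head.eq_of_beq {s t : Head} (h : s.beq t = true) : s = t := by
  cases s <;> cases t <;> simp_all [Head.beq]
  rename_i b _ _ _ b'
  cases b <;> cases b' <;> simp_all

theorem exists_feedsTo {T q : ℕ} {t : Head} {x : Letter} {k : ℕ → Head → Bool}
    (h : feed T q t x k = true) : ∃ q' t', FeedsTo T q t x q' t' ∧ k q' t' = true := by
  unfold feed at h
  cases hs : t.splits x with
  | true =>
    simp only [hs, forceNat_eq, cond_true, Bool.and_eq_true, Bool.not_eq_true'] at h
    exact ⟨_, _, ⟨Nat.ne_of_beq_eq_false h.2.1, .inl ⟨hs, h.1, rfl, rfl⟩⟩, h.2.2⟩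
  | false =>
    rw [hs, cond_false] at h
    cases hb : (x.beq other && !t.beq .empty) with
    | true => simp [hb] at h
    | false =>
      simp only [hb, forceNat_eq, forceHead_eq, cond_false, Bool.and_eq_true,
        Bool.not_eq_true'] at h
      refine ⟨_, _, ⟨Nat.ne_of_beq_eq_false h.1, .inr ⟨hs, ?_, rfl, rfl⟩⟩, h.2⟩
      rintro rfl
      apply Head.eq_of_beq
      simpa [Letter.beq] using hb

theorem headOf_cons (x : Letter) (w : List Letter) : headOf (x :: w) = (headOf w).push x := rfl

theorem headOf_ne_empty (x : Letter) (w : List Letter) : headOf (x :: w) ≠ .empty := by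
  rw [headOf_cons]
  cases headOf w with
  | empty => simp [Head.push]
  | run c m m' b =>
    unfold Head.push
    cases h : x.beq c <;> simp [h]

theorem sepChain_singleton {a : List ℤ} (ha : a ≠ []) : SepChain [a] :=
  ⟨by simpa [eq_comm] using ha, by simp⟩

/-- Separation depends on the first member only through its last letter, which does not change when
a letter is put in front. -/
theorem SepChain.cons_head {a : List ℤ} {l : List (List ℤ)} (h : SepChain (a :: l)) (x : ℤ) :
    SepChain ((x :: a) :: l) := by
  have ha : a ≠ [] := fun h0 => h.1 (by simp [h0])
  refine sepChain_cons (by simp) h.tail fun n y hy => h.separated n y ?_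
  obtain ⟨b, a, rfl⟩ := List.exists_cons_of_ne_nil ha
  simpa [List.getLast?_cons_cons] using hy

theorem SepChain.cons_cut {a : List ℤ} {l : List (List ℤ)} (h : SepChain (a :: l)) {x : ℤ}
    (ho : OtherLast a) (hx : (headOf (a.map code)).splits (code x) = true) :
    SepChain ([x] :: a :: l) := by
  refine ⟨?_, List.isChain_cons_cons.2 ⟨fun n y hy => ?_, h.2⟩⟩
  · have := h.1
    simp_all
  · obtain rfl : x = y := by simpa using hy
    exact separated_of_splits ho hx n

/-- A cut closes the leftmost piece, which must be accepted, and starts a new one with the single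
letter `x`; otherwise `x` joins that piece. A letter `other` may join only an empty piece, so it
stays last. -/
theorem Chopped.cons {T : ℕ} {u : List ℤ} {q q' : ℕ} {t t' : Head} {x : ℤ} (h : Chopped T u q t)
    (hf : FeedsTo T q t (code x) q' t') : Chopped T (x :: u) q' t' := by
  obtain ⟨r, l, rfl, hl, hp, ho, hr, rfl⟩ := h
  obtain ⟨hq, ⟨hs, ha, rfl, rfl⟩ | ⟨hs, hx, rfl, rfl⟩⟩ := hf
  · refine ⟨[x], r :: l, by simp, .inr ?_, ?_, ⟨fun _ => rfl, trivial⟩, .cons .nil hq, rfl⟩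
    · rcases hl with ⟨rfl, rfl⟩ | hl
      · simp [headOf, Head.splits] at hs
      · exact hl.cons_cut ho hs
    · intro a ha'
      rcases List.mem_cons.1 ha' with rfl | ha'
      · exact ⟨ho, q, hr, ha⟩
      · exact hp a ha'
  · refine ⟨x :: r, l, by simp, .inr ?_, hp, ⟨fun h => ?_, ho⟩, .cons hr hq, rfl⟩
    · rcases hl with ⟨rfl, rfl⟩ | hl
      · exact sepChain_singleton (by simp)
      · exact hl.cons_head x
    · cases r with
      | nil => rfl
      | cons y r => exact absurd (hx h) (headOf_ne_empty _ _)

namespace SearchTree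

variable {α : Type}

/-- Membership in a tree. -/
def Mem (b : α) : SearchTree α → Prop
  | leaf => False
  | node l _ a r => b = a ∨ l.Mem b ∨ r.Mem b

theorem mem_of_insertNew_none {eq : α → α → Bool} (heq : ∀ a b, eq a b = true → a = b) {key : ℕ}
    {a : α} {s : SearchTree α} (h : s.insertNew eq key a = none) : s.Mem a := by
  induction s with
  | leaf => simp [insertNew] at h
  | node l k b r ihl ihr =>
    unfold insertNew at h
    cases hk : Nat.ble k key with
    | true =>
      rw [hk, cond_true] at h
      cases he : (Nat.beq k key && eq a b) with
      | true =>
        rw [Bool.and_eq_true] at he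
        exact .inl (heq _ _ he.2)
      | false =>
        rw [he, cond_false] at h
        cases hr : insertNew eq key a r with
        | none => exact .inr (.inr (ihr hr))
        | some r' => simp [hr] at h
    | false =>
      rw [hk, cond_false] at h
      cases hl : insertNew eq key a l with
      | none => exact .inr (.inl (ihl hl))
      | some r' => simp [hl] at h

theorem mem_insertNew {eq : α → α → Bool} {key : ℕ} {a b : α} {s s' : SearchTree α}
    (h : s.insertNew eq key a = some s') : s'.Mem b ↔ b = a ∨ s.Mem b := by
  induction s generalizing s' with
  | leaf =>
    simp only [insertNew, Option.some.injEq] at h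
    subst h
    simp [Mem]
  | node l k c r ihl ihr =>
    unfold insertNew at h
    cases hk : Nat.ble k key with
    | true =>
      rw [hk, cond_true] at h
      cases he : (Nat.beq k key && eq a c) with
      | true => simp [he] at h
      | false =>
        rw [he, cond_false] at h
        cases hr : insertNew eq key a r with
        | none => simp [hr] at h
        | some r' =>
          simp only [hr, Option.some.injEq] at h
          subst h
          simp only [Mem, ihr hr]
          tauto
    | false =>
      rw [hk, cond_false] at h
      cases hl : insertNew eq key a l with
      | none => simp [hl] at h
      | some r' =>
        simp only [hl, Option.some.injEq] at h
        subst h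
        simp only [Mem, ihl hl]
        tauto

end SearchTree

theorem ProductNode.eq_of_beq {eq : σ → σ → Bool} (heq : ∀ a b, eq a b = true → a = b)
    (a b : ProductNode σ) (h : ProductNode.beq eq a b = true) : a = b := by
  obtain ⟨s, q, t⟩ := a
  obtain ⟨s', q', t'⟩ := b
  simp only [ProductNode.beq, Bool.and_eq_true] at h
  rw [heq _ _ h.1.1, Nat.eq_of_beq_eq_true h.1.2, Head.eq_of_beq h.2]

/-- The move is possible in the automaton and leads to a known node. -/
def MoveKnown (T q : ℕ) (t : Head) (known : ProductNode σ → Prop)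
    (v : Letter × Letter × σ) : Prop :=
  v.2.1 ≠ other ∧ ∃ q₁ t₁ q₂ t₂, FeedsTo T q t v.1 q₁ t₁ ∧ FeedsTo T q₁ t₁ v.2.1 q₂ t₂ ∧
    known ⟨v.2.2, q₂, t₂⟩

/-- The node and its moves are admissible, and the moves lead to known nodes. -/
def NodeDone (S : Source σ) (T : ℕ) (known : ProductNode σ → Prop) (a : ProductNode σ) : Prop :=
  (S.final a.src = true → a.head = .empty ∨ accepting T a.state = true) ∧
    ∀ v ∈ S.moves a.src, MoveKnown T a.state a.head known v

theorem MoveKnown.mono {T q : ℕ} {t : Head} {K K' : ProductNode σ → Prop} (hK : ∀ a, K a → K' a)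
    {v : Letter × Letter × σ} (h : MoveKnown T q t K v) : MoveKnown T q t K' v := by
  obtain ⟨h1, q₁, t₁, q₂, t₂, h2, h3, h4⟩ := h
  exact ⟨h1, q₁, t₁, q₂, t₂, h2, h3, hK _ h4⟩

theorem NodeDone.mono {S : Source σ} {T : ℕ} {K K' : ProductNode σ → Prop}
    (hK : ∀ a, K a → K' a) {a : ProductNode σ} (h : NodeDone S T K a) : NodeDone S T K' a :=
  ⟨h.1, fun v hv => (h.2 v hv).mono hK⟩

namespace Source

/-- Every node added to the tree is also put on the list of unfinished nodes; this is the
bookkeeping needed for the invariant of the search. -/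
theorem exists_of_expand {S : Source σ} (hS : ∀ a b, S.eq a b = true → a = b) {T q : ℕ} {t : Head}
    {k : List (ProductNode σ) → SearchTree (ProductNode σ) → Bool}
    {l : List (Letter × Letter × σ)} {todo : List (ProductNode σ)}
    {known : SearchTree (ProductNode σ)} (h : S.expand T q t k l todo known = true) :
    ∃ todo' known', k todo' known' = true ∧ (∀ a, known.Mem a → known'.Mem a) ∧
      (∀ a ∈ todo, a ∈ todo') ∧ (∀ a, known'.Mem a → known.Mem a ∨ a ∈ todo') ∧
      ∀ v ∈ l, MoveKnown T q t known'.Mem v := by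
  induction l generalizing todo known with
  | nil => exact ⟨todo, known, h, fun _ => id, fun _ => id, fun _ => .inl, by simp⟩
  | cons v l ih =>
    obtain ⟨c, m, s⟩ := v
    rw [expand, Bool.and_eq_true] at h
    obtain ⟨hm, h⟩ := h
    obtain ⟨q₁, t₁, hf₁, h⟩ := exists_feedsTo h
    obtain ⟨q₂, t₂, hf₂, h⟩ := exists_feedsTo h
    rw [forceNat_eq] at h
    have hm' : m ≠ other := by simpa using hm
    cases hi : known.insertNew (ProductNode.beq S.eq) (ProductNode.key S.key ⟨s, q₂, t₂⟩)
      ⟨s, q₂, t₂⟩ with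
    | none =>
      rw [hi] at h
      obtain ⟨todo', known', h1, h2, h3, h4, h5⟩ := ih h
      refine ⟨todo', known', h1, h2, h3, h4, fun v hv => ?_⟩
      rcases List.mem_cons.1 hv with rfl | hv
      · exact ⟨hm', q₁, t₁, q₂, t₂, hf₁, hf₂,
          h2 _ (SearchTree.mem_of_insertNew_none (ProductNode.eq_of_beq hS) hi)⟩
      · exact h5 v hv
    | some known₁ =>
      rw [hi] at h
      obtain ⟨todo', known', h1, h2, h3, h4, h5⟩ := ih h
      have hmem := fun b => SearchTree.mem_insertNew (b := b) hi
      refine ⟨todo', known', h1, fun a ha => h2 a ((hmem a).2 (.inr ha)),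
        fun a ha => h3 a (List.mem_cons_of_mem _ ha), fun a ha => ?_, fun v hv => ?_⟩
      · rcases h4 a ha with h | h
        · rcases (hmem a).1 h with rfl | h
          · exact .inr (h3 _ (by simp))
          · exact .inl h
        · exact .inr h
      · rcases List.mem_cons.1 hv with rfl | hv
        · exact ⟨hm', q₁, t₁, q₂, t₂, hf₁, hf₂, h2 _ ((hmem _).2 (.inl rfl))⟩
        · exact h5 v hv

/-- Invariant: every known node is unfinished or done, and done nodes stay done while the tree
grows. When no unfinished node is left, the known nodes are closed under moves. -/
theorem exists_of_search {S : Source σ} (hS : ∀ a b, S.eq a b = true → a = b) {T n : ℕ}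
    {todo : List (ProductNode σ)} {known : SearchTree (ProductNode σ)}
    (h : S.search T n todo known = true)
    (hk : ∀ a, known.Mem a → a ∈ todo ∨ NodeDone S T known.Mem a) :
    ∃ K : ProductNode σ → Prop, (∀ a, known.Mem a → K a) ∧ ∀ a, K a → NodeDone S T K a := by
  induction n generalizing todo known with
  | zero =>
    cases todo with
    | nil => exact ⟨known.Mem, fun _ => id, fun a ha => (hk a ha).resolve_left (by simp)⟩
    | cons a todo => simp [search] at h
  | succ n ih =>
    cases todo with
    | nil => exact ⟨known.Mem, fun _ => id, fun a ha => (hk a ha).resolve_left (by simp)⟩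
    | cons a todo =>
      rw [search, Bool.and_eq_true] at h
      obtain ⟨hfin, h⟩ := h
      obtain ⟨todo', known', h1, h2, h3, h4, h5⟩ := exists_of_expand hS h
      obtain ⟨K, hK, hK'⟩ := ih h1 fun b hb => by
        rcases h4 b hb with hb | hb
        · rcases hk b hb with hb | hb
          · rcases List.mem_cons.1 hb with rfl | hb
            · refine .inr ⟨fun hf => ?_, h5⟩
              simp only [hf, Bool.not_true, Bool.false_or, Bool.or_eq_true] at hfin
              exact hfin.imp_left Head.eq_of_beq
            · exact .inl (h3 b hb)
          · exact .inr (hb.mono h2)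
        · exact .inl hb
      exact ⟨K, fun b hb => hK b (h2 b hb), hK'⟩

/-- The source may write `u` and arrive in the state `s`. -/
inductive Writes (S : Source σ) : List ℤ → σ → Prop
  | nil : Writes S [] S.init
  | cons {u : List ℤ} {s s' : σ} {m c : ℤ} :
      Writes S u s → (code c, code m, s') ∈ S.moves s → Writes S (m :: c :: u) s'

/-- The closed set contains the start node, so induction along the writing of `u` keeps the node
inside it while the cuts of `u` are recorded by `Chopped`. -/
theorem exists_known {S : Source σ} (hS : ∀ a b, S.eq a b = true → a = b) {T n : ℕ}
    (h : S.check T n = true) : ∃ K : ProductNode σ → Prop, (∀ a, K a → NodeDone S T K a) ∧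
      ∀ u s, S.Writes u s → ∃ q t, K ⟨s, q, t⟩ ∧ Chopped T u q t := by
  rw [check, forceNat_eq] at h
  obtain ⟨K, hK, hK'⟩ := exists_of_search hS h (by simp [SearchTree.Mem])
  refine ⟨K, hK', fun u s hw => ?_⟩
  induction hw with
  | nil =>
    exact ⟨1, .empty, hK _ (.inl rfl), [], [], rfl, .inl ⟨rfl, rfl⟩, by simp, trivial, .nil, rfl⟩
  | cons hw hv ih =>
    obtain ⟨q, t, hq, hc⟩ := ih
    obtain ⟨-, q₁, t₁, q₂, t₂, hf₁, hf₂, hk⟩ := (hK' _ hq).2 _ hv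
    exact ⟨q₂, t₂, hk, (hc.cons hf₁).cons hf₂⟩

/-- A successful check also certifies that the source never offers a run that is too long: such runs
appear as moves with count `other`, which `Source.expand` rejects. -/
theorem move_ne_other {S : Source σ} (hS : ∀ a b, S.eq a b = true → a = b) {T n : ℕ}
    (h : S.check T n = true) {u : List ℤ} {s : σ} (hw : S.Writes u s) {v : Letter × Letter × σ}
    (hv : v ∈ S.moves s) : v.2.1 ≠ other := by
  obtain ⟨K, hK, hK'⟩ := exists_known hS h
  obtain ⟨q, t, hq, -⟩ := hK' u s hw
  exact ((hK _ hq).2 v hv).1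

theorem exists_pieces {S : Source σ} (hS : ∀ a b, S.eq a b = true → a = b) {T n : ℕ}
    (h : S.check T n = true) {u : List ℤ} {s : σ} (hw : S.Writes u s) (hs : S.final s = true) :
    ∃ l : List (List ℤ), l.flatten = u ∧ SepChain l ∧ ∀ a ∈ l, IsPiece T a := by
  obtain ⟨K, hK, hK'⟩ := exists_known hS h
  obtain ⟨q, t, hq, r, l, rfl, hl, hp, ho, hr, ht⟩ := hK' u s hw
  rcases hl with ⟨rfl, rfl⟩ | hl
  · exact ⟨[], rfl, sepChain_nil, by simp⟩
  · refine ⟨r :: l, rfl, hl, fun a ha => ?_⟩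
    rcases List.mem_cons.1 ha with rfl | ha
    · refine ⟨ho, q, hr, ((hK _ hq).1 hs).resolve_left ?_⟩
      -- An empty beginning would mean an empty leftmost piece, which a chain does not contain.
      rintro rfl
      cases a with
      | nil => exact hl.1 (by simp)
      | cons x a => exact headOf_ne_empty _ _ ht
    · exact hp a ha

end Source

/-! ### The sources write the descendants -/

theorem tableSource_eq (T : ℕ) (a b : ℕ × Letter) (h : (tableSource T).eq a b = true) : a = b := by
  obtain ⟨q, c⟩ := a
  obtain ⟨q', c'⟩ := b
  simp only [tableSource, Bool.and_eq_true, Letter.beq_iff] at h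
  rw [Nat.eq_of_beq_eq_true h.1, h.2]

theorem mem_runMoves_of_mem {T : ℕ} {x : Letter} {ms : List Letter} {q : ℕ}
    {l : List (Letter × Letter × ℕ × Letter)} {v : Letter × Letter × ℕ × Letter} (h : v ∈ l) :
    v ∈ runMoves T x ms q l := by
  induction ms generalizing q with
  | nil =>
    rw [runMoves]
    cases Nat.beq (next T q x) 0 <;> simp [h]
  | cons m ms ih =>
    rw [runMoves, forceNat_eq]
    cases Nat.beq (next T q x) 0 with
    | true => exact h
    | false =>
      cases live T x (next T q x) with
      | true => exact List.mem_cons_of_mem _ ih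
      | false => exact ih

theorem mem_runMoves {T : ℕ} {x m : Letter} {ms : List Letter} {q i : ℕ}
    {l : List (Letter × Letter × ℕ × Letter)} (hi : ms[i]? = some m)
    (h0 : ∀ j ≤ i, (fun q => next T q x)^[j + 1] q ≠ 0)
    (hl : live T x ((fun q => next T q x)^[i + 1] q) = true) :
    (x, m, (fun q => next T q x)^[i + 1] q, x) ∈ runMoves T x ms q l := by
  induction ms generalizing q i with
  | nil => simp at hi
  | cons m' ms ih =>
    have hq : Nat.beq (next T q x) 0 = false := by
      cases h : Nat.beq (next T q x) 0 with
      | false => rfl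
      | true => exact absurd (Nat.eq_of_beq_eq_true h) (h0 0 (by simp))
    rw [runMoves, forceNat_eq, hq, cond_false]
    cases i with
    | zero =>
      obtain rfl : m' = m := by simpa using hi
      rw [Function.iterate_one] at hl ⊢
      rw [hl]
      exact List.mem_cons_self
    | succ i =>
      have := ih (q := next T q x) (i := i) (by simpa using hi)
        (fun j hj => by
          have := h0 (j + 1) (by omega)
          rwa [Function.iterate_succ_apply] at this)
        (by rwa [Function.iterate_succ_apply] at hl)
      rw [Function.iterate_succ_apply (n := i + 1)]
      cases live T x (next T q x) with
      | true => exact List.mem_cons_of_mem _ this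
      | false => exact this

theorem other_mem_runMoves {T : ℕ} {x : Letter} {ms : List Letter} {q : ℕ}
    {l : List (Letter × Letter × ℕ × Letter)}
    (h0 : ∀ j ≤ ms.length, (fun q => next T q x)^[j + 1] q ≠ 0) :
    (x, other, 0, x) ∈ runMoves T x ms q l := by
  induction ms generalizing q with
  | nil =>
    have hq : Nat.beq (next T q x) 0 = false := by
      cases h : Nat.beq (next T q x) 0 with
      | false => rfl
      | true => exact absurd (Nat.eq_of_beq_eq_true h) (h0 0 (by simp))
    rw [runMoves, hq]
    exact List.mem_cons_self
  | cons m' ms ih =>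
    have hq : Nat.beq (next T q x) 0 = false := by
      cases h : Nat.beq (next T q x) 0 with
      | false => rfl
      | true => exact absurd (Nat.eq_of_beq_eq_true h) (h0 0 (by simp))
    have := ih (q := next T q x) fun j hj => by
      have := h0 (j + 1) (by simpa using hj)
      rwa [Function.iterate_succ_apply] at this
    rw [runMoves, forceNat_eq, hq, cond_false]
    cases live T x (next T q x) with
    | true => exact List.mem_cons_of_mem _ this
    | false => exact this

theorem runMoves_subset_moves {T q : ℕ} {x c : Letter} (hx : x ≠ other) (hc : x ≠ c)
    {v : Letter × Letter × ℕ × Letter} (hv : ∀ l, v ∈ runMoves T x [one, two, three] q l) :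
    v ∈ (tableSource T).moves (q, c) := by
  cases c <;> cases x <;> first | contradiction | skip
  all_goals
    simp only [tableSource]
    first
      | exact hv _
      | exact mem_runMoves_of_mem (hv _)
      | exact mem_runMoves_of_mem (mem_runMoves_of_mem (hv _))

theorem Reads.of_replicate_append {T : ℕ} {x : Letter} {w : List Letter} {n q : ℕ}
    (h : Reads T (List.replicate n x ++ w) q) : ∃ q₀, Reads T w q₀ ∧
      (fun q => next T q x)^[n] q₀ = q ∧ ∀ j < n, (fun q => next T q x)^[j + 1] q₀ ≠ 0 := by
  induction n generalizing q with
  | zero => exact ⟨q, h, rfl, by simp⟩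
  | succ n ih =>
    rw [List.replicate_succ, List.cons_append] at h
    cases h with
    | cons h hq =>
      obtain ⟨q₀, h1, rfl, h3⟩ := ih h
      refine ⟨q₀, h1, Function.iterate_succ_apply' _ _ _, fun j hj => ?_⟩
      rcases Nat.lt_succ_iff_lt_or_eq.1 hj with hj | rfl
      · exact h3 j hj
      · rwa [Function.iterate_succ_apply']

theorem OtherLast.of_append {u v : List ℤ} (h : OtherLast (u ++ v)) : OtherLast v := by
  induction u with
  | nil => exact h
  | cons x u ih => exact ih h.2

/-- This justifies the pruning in `runMoves`: a run that is maximal in an accepted string ends in a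
state where the string stops or a different letter follows. The sum of two successors vanishes only
if both are the dead state. -/
theorem live_of_next_ne {T q : ℕ} {x y : Letter} (hxy : y ≠ x) (hy : y ≠ other)
    (h : next T q y ≠ 0) : live T x q = true := by
  have key : ∀ a b : ℕ, (a ≠ 0 ∨ b ≠ 0) → (!Nat.beq (Nat.add a b) 0) = true := by
    intro a b hab
    cases h0 : Nat.beq (Nat.add a b) 0 with
    | false => rfl
    | true =>
      have := Nat.eq_of_beq_eq_true h0
      simp only [Nat.add_eq] at this
      omega
  unfold live
  cases accepting T q with
  | true => rfl
  | false =>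
    rw [cond_false]
    cases x <;> cases y <;> first | contradiction | rfl | skip
    all_goals
      apply key
      tauto

/-- Induction over runs, from the right. The hypothesis on `live` says that the first run of `p` may
end here. The letter kept in the source state is the first letter of `p`, which ensures that
neighbouring runs have different letters. -/
theorem tableSource_writes {T T' n : ℕ} (hT : (tableSource T).check T' n = true) (N : ℕ) :
    ∀ p : List ℤ, p.length ≤ N → OtherLast p → ∀ q : ℕ, Reads T (p.map code) q →
      (∀ x ∈ p.head?, live T (code x) q = true) →
      ∃ c, (tableSource T).Writes (JHC p) (q, c) ∧ ((p = [] ∧ c = other) ∨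
        c ∈ (p.map code).head?) := by
  induction N with
  | zero =>
    intro p hp _ q hq _
    obtain rfl := List.length_eq_zero_iff.1 (Nat.le_zero.1 hp)
    cases hq
    exact ⟨other, by rw [JHC_nil]; exact .nil, .inl ⟨rfl, rfl⟩⟩
  | succ N ih =>
    intro p hp ho q hq hlive
    rcases eq_or_ne p [] with rfl | hp0
    · cases hq
      exact ⟨other, by rw [JHC_nil]; exact .nil, .inl ⟨rfl, rfl⟩⟩
    obtain ⟨k, x, v, rfl, hx, hJ⟩ := exists_JHC_eq_run hp0
    rw [List.map_append, List.map_replicate] at hq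
    obtain ⟨q₀, hq₀, rfl, hne⟩ := hq.of_replicate_append
    have hox : code x = other → k = 0 ∧ v = [] := by
      intro h
      have := ho.1 h
      simpa using this
    refine ⟨code x, ?_, .inr (by simp [List.replicate_succ])⟩
    -- The run of `x` in front of `v` continues the reading with a letter different from the first
    -- letter of `v`.
    have hlv : ∀ y ∈ v.head?, live T (code y) q₀ = true := by
      intro y hy
      have hx' : code x ≠ other := fun h => by simp [(hox h).2] at hy
      refine live_of_next_ne (y := code x) (fun h => hx ?_) hx' (hne 0 (by omega))
      rw [eq_of_code_eq h hx']
      exact hy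
    obtain ⟨c, hw, hc⟩ := ih v (by simp at hp; omega) ho.of_append q₀ hq₀ hlv
    rw [hJ]
    refine hw.cons ?_
    have hlive : live T (code x) ((fun q => next T q (code x))^[k + 1] q₀) = true :=
      hlive x (by simp [List.replicate_succ])
    by_cases hxo : code x = other
    · obtain ⟨rfl, rfl⟩ := hox hxo
      cases hq₀
      obtain rfl : c = other := by simpa using hc
      rw [hxo]
      -- The rest is empty, so the state is the initial one. The move for `other` is the innermost
      -- list below the three calls of `runMoves`.
      refine mem_runMoves_of_mem (mem_runMoves_of_mem (mem_runMoves_of_mem ?_))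
      exact List.mem_singleton.2 rfl
    · have hxc : code x ≠ c := by
        rintro rfl
        rcases hc with ⟨-, h⟩ | h
        · exact hxo h
        · cases v with
          | nil => simp at h
          | cons y v =>
            have : code x = code y := by simpa [eq_comm] using h
            exact hx (by simp [eq_of_code_eq this hxo])
      -- A run of at least four letters would give the move with count `other`, excluded by the
      -- check.
      have hk : ¬ 3 ≤ k := by
        intro hk
        refine (tableSource T).move_ne_other (tableSource_eq T) hT hw
          (v := (code x, other, 0, code x)) ?_ rfl
        exact runMoves_subset_moves hxo hxc fun l => other_mem_runMoves fun j hj =>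
          hne j (by simp at hj; omega)
      refine runMoves_subset_moves hxo hxc fun l => mem_runMoves ?_ (fun j hj => hne j (by omega))
        hlive
      interval_cases k <;> rfl

/-- The string of the next day of an accepted string is cut into accepted strings of the next
automaton. -/
theorem exists_pieces_JHC {T T' n : ℕ} (hT : (tableSource T).check T' n = true) {p : List ℤ}
    (hp : IsPiece T p) :
    ∃ l : List (List ℤ), l.flatten = JHC p ∧ SepChain l ∧ ∀ a ∈ l, IsPiece T' a := by
  obtain ⟨ho, q, hq, ha⟩ := hp
  obtain ⟨c, hw, -⟩ := tableSource_writes hT _ p le_rfl ho q hq fun x _ => by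
    simp [live, ha]
  exact (tableSource T).exists_pieces (tableSource_eq T) hT hw ha

/-- `w` is the concatenation of strings with the property `P` whose descendants never interfere. -/
def Decomposes (P : List ℤ → Prop) (w : List ℤ) : Prop :=
  ∃ l : List (List ℤ), l.flatten = w ∧ SepChain l ∧ ∀ a ∈ l, P a

/-- The descendants of the members of a chain form a chain again, and each of them may be replaced
by a finer chain. -/
theorem Decomposes.iterate {P Q : List ℤ → Prop} {k : ℕ}
    (h : ∀ a, P a → Decomposes Q (JHC^[k] a)) {w : List ℤ} (hw : Decomposes P w) :
    Decomposes Q (JHC^[k] w) := by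
  obtain ⟨l, rfl, hl, hp⟩ := hw
  choose! f hf using h
  have hmap : (l.map f).map List.flatten = l.map JHC^[k] := by
    rw [List.map_map]
    exact List.map_congr_left fun a ha => (hf a (hp a ha)).1
  refine ⟨(l.map f).flatten, ?_, SepChain.flatten ?_ ?_, ?_⟩
  · rw [List.flatten_flatten, hmap, hl.iterate_flatten]
  · simpa using fun a ha => (hf a (hp a ha)).2.1
  · rw [hmap]
    exact hl.iterate k
  · intro a ha
    simp only [List.mem_flatten, List.mem_map] at ha
    obtain ⟨-, ⟨b, hb, rfl⟩, ha⟩ := ha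
    exact (hf b (hp b hb)).2.2 a ha

theorem Decomposes.of_check {T T' n : ℕ} (hT : (tableSource T).check T' n = true)
    {w : List ℤ} (hw : Decomposes (IsPiece T) w) : Decomposes (IsPiece T') (JHC w) :=
  hw.iterate (k := 1) fun _ ha => exists_pieces_JHC hT ha

/-! ### Two-day-old strings -/

/-- Strings of pairs of a count and a value, in which neighbouring values differ. -/
inductive PairString : List ℤ → Prop
  | nil : PairString []
  | single (m a : ℤ) : PairString [m, a]
  | cons (m : ℤ) {a n b : ℤ} {u : List ℤ} : a ≠ b → PairString (n :: b :: u) →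
      PairString (m :: a :: n :: b :: u)

theorem pairString_JHC (w : List ℤ) : PairString (JHC w) := by
  induction w with
  | nil => rw [JHC_nil]; exact .nil
  | cons x w ih =>
    cases w with
    | nil => rw [JHC_cons, JHC_nil]; exact .single 1 x
    | cons y w =>
      obtain ⟨m, t, h⟩ := exists_JHC_cons y w
      rw [JHC_cons, h, pushLetter_cons_cons]
      rw [h] at ih
      split_ifs with hxy
      · cases ih with
        | single => exact .single _ _
        | cons _ h1 h2 => exact .cons _ h1 h2
      · exact .cons _ hxy ih

theorem baseSource_eq (a b : BaseState) (h : baseSource.eq a b = true) : a = b := by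
  cases a <;> cases b <;> simp_all [baseSource, BaseState.beq]

/-- Different integers may share the symbol `other`, so only the symbols `1`, `2`, `3` can be
excluded. -/
theorem mem_lettersExcept {x y : ℤ} {l : List Letter} (hl : code x ∈ l) (h : x ≠ y) :
    code x ∈ BaseState.lettersExcept (code y) l := by
  refine List.mem_filter.2 ⟨hl, ?_⟩
  by_cases hx : code x = other
  · simp [hx]
  · have : code x ≠ code y := fun h' => h (eq_of_code_eq h' hx)
    simp [this]

theorem mem_letters (x : Letter) : x ∈ [one, two, three, other] := by
  cases x <;> simp

/-- What the source remembers of a string that begins with a count. -/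
def CountState (w : List ℤ) (s : BaseState) : Prop :=
  (w = [] ∧ s = .init) ∨ ∃ m a u, w = m :: a :: u ∧
    ((m = a ∧ s = .count (code m)) ∨ s = .loneCount (code m) (code a))

theorem CountState.final {w : List ℤ} {s : BaseState} (h : CountState w s) :
    baseSource.final s = true := by
  rcases h with ⟨-, rfl⟩ | ⟨m, a, u, -, ⟨-, rfl⟩ | rfl⟩ <;> rfl

/-- A run of values at the beginning may be written next. -/
theorem CountState.moves {w : List ℤ} {s : BaseState} (h : CountState w s) {x : ℤ}
    (hx : ∀ m a u, w = m :: a :: u → x ≠ m ∧ x ≠ a) :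
    (code x, one, BaseState.value (code x)) ∈ baseSource.moves s ∧
      (code x, two, BaseState.count (code x)) ∈ baseSource.moves s := by
  rcases h with ⟨-, rfl⟩ | ⟨m, a, u, rfl, ⟨-, rfl⟩ | rfl⟩
  · exact ⟨List.mem_flatMap.2 ⟨code x, mem_letters _, by simp⟩,
      List.mem_flatMap.2 ⟨code x, mem_letters _, by simp⟩⟩
  · have := mem_lettersExcept (mem_letters (code x)) (hx m a u rfl).1
    exact ⟨List.mem_flatMap.2 ⟨code x, this, by simp⟩, List.mem_flatMap.2 ⟨code x, this, by simp⟩⟩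
  · have := mem_lettersExcept (mem_lettersExcept (mem_letters (code x)) (hx m a u rfl).1)
      (hx m a u rfl).2
    exact ⟨List.mem_flatMap.2 ⟨code x, this, by simp⟩, List.mem_flatMap.2 ⟨code x, this, by simp⟩⟩

theorem value_moves {x y : ℤ} (h : x ≠ y) :
    (code x, one, BaseState.loneCount (code x) (code y)) ∈
        baseSource.moves (.value (code y)) ∧
      (code x, two, BaseState.value (code x)) ∈ baseSource.moves (.value (code y)) ∧
      (code x, three, BaseState.count (code x)) ∈ baseSource.moves (.value (code y)) := by
  have := mem_lettersExcept (mem_letters (code x)) h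
  exact ⟨List.mem_flatMap.2 ⟨code x, this, by simp⟩, List.mem_flatMap.2 ⟨code x, this, by simp⟩,
    List.mem_flatMap.2 ⟨code x, this, by simp⟩⟩

theorem JHC_double {x : ℤ} {v : List ℤ} (h : x ∉ v.head?) :
    JHC (x :: x :: v) = 2 :: x :: JHC v :=
  JHC_run (m := 2) (by simp) h

theorem JHC_triple {x : ℤ} {v : List ℤ} (h : x ∉ v.head?) :
    JHC (x :: x :: x :: v) = 3 :: x :: JHC v :=
  JHC_run (m := 3) (by simp) h

/-- Values two places apart differ, so runs have length at most `3`, and a run of three is count,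
value, count. Removing the first run leaves a string that begins with a count or one that begins
with a value. Hence the two statements are proved together, by strong induction on the length. -/
theorem PairString.exists_writes (N : ℕ) : ∀ w : List ℤ, w.length ≤ N → PairString w →
    (∃ s, baseSource.Writes (JHC w) s ∧ CountState w s) ∧
    ∀ x, (∀ m a u, w = m :: a :: u → x ≠ a) →
      baseSource.Writes (JHC (x :: w)) (.value (code x)) := by
  induction N using Nat.strong_induction_on with
  | _ N ih =>
  intro w hN hw
  have hcount : ∃ s, baseSource.Writes (JHC w) s ∧ CountState w s := by
    cases hw with
    | nil => exact ⟨.init, by rw [JHC_nil]; exact .nil, .inl ⟨rfl, rfl⟩⟩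
    | single m a =>
      have hr := ih 1 (by simp at hN; omega) [] (by simp) .nil
      by_cases hma : m = a
      · subst hma
        rw [JHC_double (by simp)]
        obtain ⟨s, hs, hs'⟩ := hr.1
        exact ⟨_, hs.cons (hs'.moves (by simp)).2, .inr ⟨m, m, [], rfl, .inl ⟨rfl, rfl⟩⟩⟩
      · rw [JHC_cons_of_notMem (by simpa [eq_comm] using hma)]
        exact ⟨_, (hr.2 a (by simp)).cons (value_moves hma).1, .inr ⟨m, a, [], rfl, .inr rfl⟩⟩
    | @cons m a n b u hab hu =>
      simp only [List.length_cons] at hN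
      have hr := ih (u.length + 2) (by omega) (n :: b :: u) (by simp) hu
      by_cases hma : m = a
      · subst hma
        by_cases hn : m = n
        · subst hn
          -- A count, its value and the next count form a run of three; what remains begins with the
          -- value `b`.
          rw [JHC_triple (by simpa [eq_comm] using hab)]
          refine ⟨_, Source.Writes.cons ?_ (value_moves hab).2.2,
            .inr ⟨m, m, _, rfl, .inl ⟨rfl, rfl⟩⟩⟩
          cases hu with
          | single => exact (ih 0 (by omega) [] (by simp) .nil).2 b (by simp)
          | @cons _ _ n' b' u' hb hu' =>
            refine (ih (u'.length + 2) (by simp at hN; omega) _ (by simp) hu').2 b ?_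
            rintro m' a' u'' h
            simp only [List.cons.injEq] at h
            rwa [← h.2.1]
        · rw [JHC_double (by simpa [eq_comm] using hn)]
          obtain ⟨s, hs, hs'⟩ := hr.1
          refine ⟨_, hs.cons (hs'.moves ?_).2, .inr ⟨m, m, _, rfl, .inl ⟨rfl, rfl⟩⟩⟩
          rintro m' a' u'' h
          simp only [List.cons.injEq] at h
          rw [← h.1, ← h.2.1]
          exact ⟨hn, hab⟩
      · rw [JHC_cons_of_notMem (by simpa [eq_comm] using hma)]
        refine ⟨_, (hr.2 a ?_).cons (value_moves hma).1, .inr ⟨m, a, _, rfl, .inr rfl⟩⟩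
        rintro m' a' u'' h
        simp only [List.cons.injEq] at h
        rwa [← h.2.1]
  refine ⟨hcount, fun x hx => ?_⟩
  by_cases hxw : x ∈ w.head?
  · -- a value and the count after it form a run
    cases hw with
    | nil => simp at hxw
    | single m a =>
      obtain rfl : m = x := by simpa using hxw
      have hma := hx m a [] rfl
      rw [JHC_double (by simpa [eq_comm] using hma)]
      exact ((ih 0 (by simp at hN; omega) [] (by simp) .nil).2 a (by simp)).cons
        (value_moves hma).2.1
    | @cons m a n b u hab hu =>
      simp only [List.length_cons] at hN
      obtain rfl : m = x := by simpa using hxw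
      have hma := hx m a _ rfl
      rw [JHC_double (by simpa [eq_comm] using hma)]
      refine ((ih (u.length + 2) (by omega) _ (by simp) hu).2 a ?_).cons (value_moves hma).2.1
      rintro m' a' u'' h
      simp only [List.cons.injEq] at h
      rwa [← h.2.1]
  · rw [JHC_cons_of_notMem hxw]
    obtain ⟨s, hs, hs'⟩ := hcount
    refine hs.cons (hs'.moves ?_).1
    rintro m a u rfl
    exact ⟨by simpa [eq_comm] using hxw, hx m a u rfl⟩

/-- Two-day-old strings are cut into pieces accepted by an automaton that passes the check. -/
theorem exists_pieces_JHC_JHC {T n : ℕ} (hT : baseSource.check T n = true) (w : List ℤ) :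
    ∃ l : List (List ℤ), l.flatten = JHC (JHC w) ∧ SepChain l ∧ ∀ a ∈ l, IsPiece T a := by
  obtain ⟨s, hs, hs'⟩ := ((pairString_JHC w).exists_writes _ _ le_rfl).1
  exact baseSource.exists_pieces baseSource_eq hT hs hs'.final

/-! ### Computations with words -/

/-- `pushLetter` for words in the symbols. -/
def sayPush (x : Letter) : List Letter → List Letter
  | m :: c :: t => bif x.beq c then m.succ :: c :: t else one :: x :: m :: c :: t
  | t => one :: x :: t

/-- `JHC` for words in the symbols. -/
def say (w : List Letter) : List Letter :=
  w.foldr sayPush []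

/-- Whether only the last letter may be `other`. -/
def otherLast : List Letter → Bool
  | [] => true
  | x :: w => (!x.beq other || w.isEmpty) && otherLast w

/-- Add a letter to a list of pieces, given with the beginning of its first member. -/
def chopPush (x : Letter) : List (List Letter) × Head → List (List Letter) × Head
  | ([], _) => ([[x]], .run x one other true)
  | (r :: l, t) =>
    bif t.splits x then ([x] :: r :: l, .run x one other true) else ((x :: r) :: l, t.push x)

/-- Cut a word at all recognized splittings. -/
def chop (w : List Letter) : List (List Letter) × Head :=
  w.foldr chopPush ([], .empty)

/-- The number with the digits `w`. -/
def value (w : List Letter) : ℕ :=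
  w.foldl (fun n x => Nat.add (Nat.mul 10 n) x.toNat) 0

/-- The transuranic elements without their last letters. -/
def transuranicCodes : List ℕ :=
  [31221132221222112112322211, 1311222113321132211221121332211]

/-- Whether a word is a stable or a transuranic element. -/
def isFinal (w : List Letter) : Bool :=
  otherLast w &&
    bif w.any (Letter.beq other) then
      forceNat (value (w.filter fun x => !other.beq x)) fun n => transuranicCodes.any (Nat.beq n)
    else forceNat (value w) fun n => stableCodes.any (Nat.beq n)

/-- Whether a word decays in `k` days. -/
def decays : ℕ → List Letter → Bool
  | 0, w => isFinal w
  | k + 1, w => isFinal w || (otherLast (say w) && (chop (say w)).1.all (decays k))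

/-- Whether all words that are accepted when one goes on from the state `q`, where one has arrived
by reading `w`, decay in `k` days and are shorter than `w` by less than `n` letters. -/
def acceptedDecay (T k : ℕ) : ℕ → ℕ → List Letter → Bool
  | 0, _, _ => false
  | n + 1, q, w => (!accepting T q || decays k w) &&
      [one, two, three, other].all fun x => forceNat (next T q x) fun q' =>
        Nat.beq q' 0 || acceptedDecay T k n q' (x :: w)

/-- Whether some descendant of `w` on the first `k` days begins with `x`. -/
def collides (x : Letter) : ℕ → List Letter → Bool
  | 0, _ => false
  | k + 1, w => (match w with | [] => false | y :: _ => x.beq y) ||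
      (otherLast (say w) && collides x k (say w))

/-- Whether no cut of the word is a splitting, as seen in `k` days. -/
def unsplit (k : ℕ) : List Letter → Bool
  | [] => true
  | x :: w => (w.isEmpty || collides x k w) && unsplit k w

/-- The symbol for a digit. -/
def digitLetter (d : ℕ) : Letter :=
  bif Nat.beq d 1 then one else bif Nat.beq d 2 then two else bif Nat.beq d 3 then three else other

/-- The word of the digits of `n`, followed by `w`. -/
def digitWord : ℕ → ℕ → List Letter → List Letter
  | 0, _, w => w
  | k + 1, n, w => bif Nat.beq n 0 then w else
      forceNat (Nat.div n 10) fun n' => forceLetter (digitLetter (Nat.mod n 10)) fun x =>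
        digitWord k n' (x :: w)

/-- All stable and transuranic elements. -/
def finalWords : List (List Letter) :=
  (stableCodes.map fun n => digitWord 50 n []) ++
    transuranicCodes.map fun n => digitWord 50 n [other]

/-- Whether the final words are elements and decay into final words. -/
def finalWordsCheck : Bool :=
  finalWords.all fun w => unsplit 10 w && otherLast (say w) && (chop (say w)).1.all isFinal

/-- Ten days, from day `0` to day `9`, suffice to see a collision at every cut of a final word. The
rest of the check says that being cut into final words persists to the next day. -/
theorem finalWordsCheck_eq_true : finalWordsCheck = true := by decide +kernel

/-- The traversal fails when its fuel is used up, so `81` units allow words of at most `80` letters.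
Termination also shows that the automaton has no reachable cycle of live states. -/
theorem acceptedDecay_table9 :
    forceNat table9 (fun T => acceptedDecay T 20 81 1 []) = true := by decide +kernel

/-- The integer for a symbol, with `n` for `other`. -/
def decode (n : ℤ) : Letter → ℤ
  | one => 1
  | two => 2
  | three => 3
  | other => n

variable {n : ℤ}

theorem code_decode (hn : code n = other) (x : Letter) : code (decode n x) = x := by
  cases x <;> simp [decode, hn]

theorem decode_injective (hn : code n = other) : Function.Injective (decode n) :=
  Function.LeftInverse.injective (code_decode hn)

theorem map_code_map_decode (hn : code n = other) (w : List Letter) :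
    (w.map (decode n)).map code = w := by
  rw [List.map_map]
  conv_rhs => rw [← List.map_id w]
  exact List.map_congr_left fun x _ => code_decode hn x

theorem decode_succ {x : Letter} (h : x.succ ≠ other) : decode n x.succ = decode n x + 1 := by
  cases x <;> simp_all [Letter.succ, decode]

theorem otherLast_cons {x : Letter} {w : List Letter} :
    otherLast (x :: w) = true ↔ (x = other → w = []) ∧ otherLast w = true := by
  simp only [otherLast, Bool.and_eq_true, Bool.or_eq_true, Bool.not_eq_true', Letter.beq_eq_false,
    List.isEmpty_iff]
  tauto

theorem OtherLast.map_decode (hn : code n = other) {w : List Letter} (h : otherLast w = true) :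
    OtherLast (w.map (decode n)) := by
  induction w with
  | nil => trivial
  | cons x w ih =>
    rw [otherLast_cons] at h
    refine ⟨fun hx => ?_, ih h.2⟩
    rw [code_decode hn] at hx
    simp [h.1 hx]

/-- A string in which only the last letter may differ from `1`, `2`, `3` comes from a word. -/
theorem OtherLast.exists_decode {w : List ℤ} (h : OtherLast w) :
    ∃ n, code n = other ∧ (w.map code).map (decode n) = w := by
  induction w with
  -- Without a letter `other`, any integer different from `1`, `2`, `3` would serve.
  | nil => exact ⟨4, rfl, rfl⟩
  | cons x w ih =>
    by_cases hx : code x = other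
    · obtain rfl := h.1 hx
      exact ⟨x, hx, by simp [hx, decode]⟩
    · obtain ⟨n, hn, hw⟩ := ih h.2
      refine ⟨n, hn, ?_⟩
      rw [List.map_cons, List.map_cons, hw,
        eq_of_code_eq (x := decode n (code x)) (y := x) (code_decode hn _)
          (by rwa [code_decode hn])]

/-- The symbolic computation goes wrong only when a count exceeds `3`. Such a count becomes `other`
in front of a value, and the hypothesis on `say w` rules this out. -/
theorem JHC_map_decode (hn : code n = other) {w : List Letter} (h : otherLast (say w) = true) :
    JHC (w.map (decode n)) = (say w).map (decode n) := by
  induction w with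
  | nil => simp [say, JHC_nil]
  | cons x w ih =>
    have hs : say (x :: w) = sayPush x (say w) := rfl
    rw [hs] at h ⊢
    rw [List.map_cons, JHC_cons]
    rcases hw : say w with _ | ⟨m, _ | ⟨c, t⟩⟩
    · rw [ih (by rw [hw]; rfl), hw]
      rfl
    · rw [hw] at h
      rw [ih, hw]
      · rfl
      · rw [hw]
        simp only [sayPush, otherLast_cons] at h
        simp [otherLast]
    · rw [hw, sayPush] at h
      rw [sayPush]
      cases hxc : x.beq c with
      | true =>
        obtain rfl := Letter.beq_iff.1 hxc
        rw [hxc, cond_true, otherLast_cons] at h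
        -- The count is followed by the value, so it is not the last letter.
        have hm : m.succ ≠ other := fun h' => by simpa using h.1 h'
        rw [ih, hw, List.map_cons, List.map_cons, pushLetter_cons_cons, if_pos rfl, cond_true,
          List.map_cons, decode_succ hm, List.map_cons]
        rw [hw, otherLast_cons]
        exact ⟨fun h' => absurd (by simp [h', Letter.succ]) hm, h.2⟩
      | false =>
        rw [hxc, cond_false, otherLast_cons, otherLast_cons] at h
        have hx := (decode_injective hn).ne (Letter.beq_eq_false.1 hxc)
        rw [ih (by rw [hw]; exact h.2.2), hw, List.map_cons, List.map_cons, pushLetter_cons_cons,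
          if_neg hx]
        rfl

/-- At most one letter is `other`, so a single `n` decodes the whole word and the recognized cuts
are splittings of the decoded string. -/
theorem chop_spec (hn : code n = other) {w : List Letter} (h : otherLast w = true) :
    (w = [] ∧ chop w = ([], .empty)) ∨
      ∃ r l, chop w = (r :: l, headOf r) ∧ otherLast r = true ∧ (r :: l).flatten = w ∧
        SepChain ((r :: l).map (List.map (decode n))) := by
  induction w with
  | nil => exact .inl ⟨rfl, rfl⟩
  | cons x w ih =>
    have hc : chop (x :: w) = chopPush x (chop w) := rfl
    rw [otherLast_cons] at h
    refine .inr ?_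
    rcases ih h.2 with ⟨rfl, h1⟩ | ⟨r, l, h1, h2, h3, h4⟩
    · refine ⟨[x], [], by rw [hc, h1]; rfl, by simp [otherLast], rfl, ?_⟩
      exact sepChain_singleton (by simp)
    · have hx : x ≠ other := by
        intro hx
        rw [h.1 hx] at h1
        simp [chop] at h1
      rw [hc, h1, chopPush]
      cases hs : (headOf r).splits x with
      | true =>
        refine ⟨[x], r :: l, rfl, by simp [otherLast], by simp [← h3], ?_⟩
        refine SepChain.cons_cut h4 (OtherLast.map_decode hn h2) ?_
        rwa [map_code_map_decode hn, code_decode hn]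
      | false =>
        refine ⟨x :: r, l, rfl, otherLast_cons.2 ⟨fun h' => absurd h' hx, h2⟩, by simp [← h3], ?_⟩
        exact SepChain.cons_head h4 _

/-! ### Final strings: cutting, digits, indecomposability and decay -/

/-- The stable and transuranic elements, as strings. -/
def IsFinalString (a : List ℤ) : Prop :=
  ∃ n w, code n = other ∧ isFinal w = true ∧ a = w.map (decode n)

theorem decomposes_of_chop (hn : code n = other) {P : List ℤ → Prop} {w : List Letter}
    (hs : otherLast (say w) = true) (hP : ∀ v ∈ (chop (say w)).1, P (v.map (decode n))) :
    Decomposes P (JHC^[1] (w.map (decode n))) := by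
  rw [Function.iterate_one, JHC_map_decode hn hs]
  rcases chop_spec hn hs with ⟨h1, -⟩ | ⟨r, l, h1, -, h3, h4⟩
  · rw [h1]
    exact ⟨[], rfl, sepChain_nil, by simp⟩
  · refine ⟨_, ?_, h4, ?_⟩
    · rw [← List.map_flatten, h3]
    · intro a ha
      obtain ⟨v, hv, rfl⟩ := List.mem_map.1 ha
      exact hP v (by rwa [h1])

theorem value_append (w : List Letter) (x : Letter) :
    value (w ++ [x]) = 10 * value w + x.toNat := by
  simp [value]

theorem digitLetter_toNat (x : Letter) : digitLetter x.toNat = x := by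
  cases x <;> rfl

theorem Letter.toNat_pos_lt (x : Letter) : 0 < x.toNat ∧ x.toNat < 10 := by
  cases x <;> simp [Letter.toNat]

/-- No symbol has the digit `0`, so the word can be recovered from its value without loss of leading
letters. This reduces statements about all final words to the finite list `finalWords`. -/
theorem digitWord_value (w v : List Letter) {k : ℕ} (hk : value w < 10 ^ k) :
    digitWord k (value w) v = w ++ v := by
  induction w using List.reverseRecOn generalizing k v with
  | nil => cases k <;> rfl
  | append_singleton w x ih =>
    have hx := x.toNat_pos_lt
    have hv := value_append w x
    rw [hv] at hk
    cases k with
    | zero => omega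
    | succ k =>
      have h0 : Nat.beq (value (w ++ [x])) 0 = false := by
        cases h : Nat.beq (value (w ++ [x])) 0 with
        | false => rfl
        | true =>
          have := Nat.eq_of_beq_eq_true h
          omega
      have h1 : Nat.div (value (w ++ [x])) 10 = value w := by
        change value (w ++ [x]) / 10 = value w
        omega
      have h2 : Nat.mod (value (w ++ [x])) 10 = x.toNat := by
        change value (w ++ [x]) % 10 = x.toNat
        omega
      rw [digitWord, h0, cond_false, forceNat_eq, forceLetter_eq, h1, h2, digitLetter_toNat,
        ih _ (by rw [pow_succ] at hk; omega), List.append_assoc]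
      rfl

theorem digitString_eq_map (n : ℕ) :
    digitString n = (Nat.digits 10 n).reverse.map fun d : ℕ => (d : ℤ) := by
  simp [digitString, List.map_eq_flatMap]

theorem digitString_value {w : List Letter} (hw : other ∉ w) (n : ℤ) :
    digitString (value w) = w.map (decode n) := by
  induction w using List.reverseRecOn with
  | nil => simp [value, digitString]
  | append_singleton w x ih =>
    have hx := x.toNat_pos_lt
    have hv := value_append w x
    rw [List.mem_append, not_or] at hw
    rw [List.map_append, ← ih hw.1, digitString_eq_map, Nat.digits_def' (by norm_num) (by omega)]
    have h1 : value (w ++ [x]) / 10 = value w := by omega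
    have h2 : value (w ++ [x]) % 10 = x.toNat := by omega
    rw [h1, h2, List.reverse_cons, List.map_append, digitString_eq_map]
    cases x <;> simp_all [decode, Letter.toNat]

theorem eq_filter_append {w : List Letter} (h : otherLast w = true) (ho : other ∈ w) :
    w = w.filter (fun x => !other.beq x) ++ [other] := by
  induction w with
  | nil => simp at ho
  | cons x w ih =>
    rw [otherLast_cons] at h
    by_cases hx : x = other
    · rw [h.1 hx, hx]
      rfl
    · have ho : other ∈ w := by
        rcases List.mem_cons.1 ho with h | h
        · exact absurd h.symm hx
        · exact h
      have hx : (!other.beq x) = true := by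
        rw [Bool.not_eq_true', Letter.beq_eq_false]
        exact Ne.symm hx
      rw [List.filter_cons_of_pos (p := fun x => !other.beq x) hx, List.cons_append, ← ih h.2 ho]

theorem any_beq_iff {l : List ℕ} {n : ℕ} : l.any (Nat.beq n) = true ↔ n ∈ l := by
  rw [List.any_eq_true]
  constructor
  · rintro ⟨m, hm, h⟩
    rwa [Nat.eq_of_beq_eq_true h]
  · exact fun h => ⟨n, h, Nat.beq_refl n⟩

/-- The two kinds of final words. -/
theorem isFinal_cases {w : List Letter} (h : isFinal w = true) :
    (other ∉ w ∧ value w ∈ stableCodes) ∨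
      ∃ u, other ∉ u ∧ w = u ++ [other] ∧ value u ∈ transuranicCodes := by
  rw [isFinal, Bool.and_eq_true] at h
  cases ho : w.any (Letter.beq other) with
  | true =>
    rw [ho, cond_true, forceNat_eq, any_beq_iff] at h
    have ho : other ∈ w := by simpa using ho
    refine .inr ⟨w.filter fun x => !other.beq x, ?_, eq_filter_append h.1 ho, h.2⟩
    simp
  | false =>
    rw [ho, cond_false, forceNat_eq, any_beq_iff] at h
    refine .inl ⟨fun h' => ?_, h.2⟩
    rw [List.any_eq_false] at ho
    exact ho _ h' (by simp)

theorem code_lt : ∀ n ∈ stableCodes ++ transuranicCodes, n < 10 ^ 50 := by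
  decide +kernel

theorem mem_finalWords {w : List Letter} (h : isFinal w = true) : w ∈ finalWords := by
  rcases isFinal_cases h with ⟨-, hv⟩ | ⟨u, -, rfl, hv⟩
  · refine List.mem_append_left _ (List.mem_map.2 ⟨_, hv, ?_⟩)
    rw [digitWord_value _ _ (code_lt _ (List.mem_append_left _ hv)), List.append_nil]
  · exact List.mem_append_right _ (List.mem_map.2
      ⟨_, hv, digitWord_value _ _ (code_lt _ (List.mem_append_right _ hv))⟩)

theorem IsFinalString.isStable_or_isTransuranic {a : List ℤ} (h : IsFinalString a) :
    IsStable a ∨ IsTransuranic a := by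
  obtain ⟨n, w, hn, hw, rfl⟩ := h
  rcases isFinal_cases hw with ⟨ho, hv⟩ | ⟨u, ho, rfl, hv⟩
  · exact .inl ⟨_, hv, (digitString_value ho n).symm⟩
  · rw [List.map_append, ← digitString_value ho n]
    refine .inr ⟨n, (code_eq_other.1 hn).1, (code_eq_other.1 hn).2.1, (code_eq_other.1 hn).2.2, ?_⟩
    simp only [transuranicCodes, List.mem_cons, List.not_mem_nil, or_false] at hv
    rcases hv with hv | hv
    · exact .inl (by rw [hv]; rfl)
    · exact .inr (by rw [hv]; rfl)

theorem exists_of_collides (hn : code n = other) {x : Letter} {k : ℕ} {w : List Letter}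
    (h : collides x k w = true) :
    ∃ j : ℕ, decode n x ∈ (JHC^[j] (w.map (decode n))).head? := by
  induction k generalizing w with
  | zero => simp [collides] at h
  | succ k ih =>
    rw [collides.eq_def, Bool.or_eq_true, Bool.and_eq_true] at h
    rcases h with h | ⟨h1, h2⟩
    · cases w with
      | nil => simp at h
      | cons y w =>
        obtain rfl := Letter.beq_iff.1 h
        exact ⟨0, by simp⟩
    · obtain ⟨j, hj⟩ := ih h2
      refine ⟨j + 1, ?_⟩
      rwa [Function.iterate_succ_apply, JHC_map_decode hn h1]

theorem collides_of_unsplit {k : ℕ} {u v : List Letter} {x : Letter}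
    (h : unsplit k (u ++ x :: v) = true) (hv : v ≠ []) : collides x k v = true := by
  induction u with
  | nil =>
    rw [List.nil_append, unsplit, Bool.and_eq_true, Bool.or_eq_true, List.isEmpty_iff] at h
    exact h.1.resolve_left hv
  | cons y u ih =>
    rw [List.cons_append, unsplit, Bool.and_eq_true] at h
    exact ih h.2

/-- Only the last letter of the left part matters for a splitting, so one collision found for each
cut suffices. -/
theorem isElement_of_unsplit (hn : code n = other) {k : ℕ} {w : List Letter} (hw : w ≠ [])
    (h : unsplit k w = true) : IsElement (w.map (decode n)) := by
  refine ⟨by simpa using hw, fun L R he hs => ?_⟩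
  by_contra hc
  push Not at hc
  obtain ⟨u, v, rfl, rfl, rfl⟩ := List.map_eq_append_iff.1 he
  have hu : u ≠ [] := by simpa using hc.1
  have hv : v ≠ [] := by simpa using hc.2
  obtain ⟨u, x, rfl⟩ := (List.eq_nil_or_concat' u).resolve_left hu
  rw [List.append_assoc, List.singleton_append] at h
  obtain ⟨j, hj⟩ := exists_of_collides hn (collides_of_unsplit h hv)
  exact hs.separated j _ (by simp) hj

theorem finalWords_spec {w : List Letter} (h : isFinal w = true) :
    unsplit 10 w = true ∧ otherLast (say w) = true ∧ (chop (say w)).1.all isFinal = true := by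
  have := List.all_eq_true.1 finalWordsCheck_eq_true w (mem_finalWords h)
  rw [Bool.and_eq_true, Bool.and_eq_true] at this
  exact ⟨this.1.1, this.1.2, this.2⟩

theorem IsFinalString.isElement {a : List ℤ} (h : IsFinalString a) : IsElement a := by
  obtain ⟨n, w, hn, hw, rfl⟩ := h
  refine isElement_of_unsplit hn ?_ (finalWords_spec hw).1
  -- The empty word has value `0`, which is not among the codes.
  rintro rfl
  revert hw
  decide +kernel

theorem IsFinalString.decomposes {a : List ℤ} (h : IsFinalString a) (k : ℕ) :
    Decomposes IsFinalString (JHC^[k] a) := by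
  induction k with
  | zero => exact ⟨[a], by simp, sepChain_singleton h.isElement.1, by simpa using h⟩
  | succ k ih =>
    -- The single day is taken last, after the `k` days of the induction hypothesis.
    rw [add_comm, Function.iterate_add_apply]
    refine ih.iterate fun b hb => ?_
    obtain ⟨n, w, hn, hw, rfl⟩ := hb
    obtain ⟨-, h1, h2⟩ := finalWords_spec hw
    exact decomposes_of_chop hn h1 fun v hv => ⟨n, v, hn, List.all_eq_true.1 h2 v hv, rfl⟩

/-- Parts that become final early keep decaying into final strings, so all parts can be compared on
the same day `k`. -/
theorem decomposes_of_decays (hn : code n = other) {k : ℕ} {w : List Letter}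
    (h : decays k w = true) : Decomposes IsFinalString (JHC^[k] (w.map (decode n))) := by
  induction k generalizing w with
  | zero => exact IsFinalString.decomposes ⟨n, w, hn, h, rfl⟩ 0
  | succ k ih =>
    rw [decays, Bool.or_eq_true, Bool.and_eq_true] at h
    rcases h with h | ⟨h1, h2⟩
    · exact IsFinalString.decomposes ⟨n, w, hn, h, rfl⟩ _
    · rw [Function.iterate_add_apply]
      refine Decomposes.iterate (P := fun a => Decomposes IsFinalString (JHC^[k] a))
        (fun _ => id) ?_
      exact decomposes_of_chop hn h1 fun v hv => ih (List.all_eq_true.1 h2 v hv)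

/-- The traversal follows every reading of the automaton; fuel and letters read add up to the
initial fuel. -/
theorem Reads.acceptedDecay {T k N : ℕ} (hT : acceptedDecay T k N 1 [] = true) {w : List Letter}
    {q : ℕ} (h : Reads T w q) :
    ∃ m, m + w.length = N ∧ acceptedDecay T k m q w = true := by
  induction h with
  | nil => exact ⟨N, rfl, hT⟩
  | @cons x w q h hq ih =>
    obtain ⟨m, hm, hd⟩ := ih
    cases m with
    | zero => simp [_root_.acceptedDecay] at hd
    | succ m =>
      refine ⟨m, by simp; omega, ?_⟩
      rw [_root_.acceptedDecay, Bool.and_eq_true, List.all_eq_true] at hd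
      have := hd.2 x (mem_letters x)
      rw [forceNat_eq, Bool.or_eq_true] at this
      exact this.resolve_left fun h0 => hq (Nat.eq_of_beq_eq_true h0)

theorem IsPiece.decays {T k N : ℕ} (hT : acceptedDecay T k (N + 1) 1 [] = true) {a : List ℤ}
    (h : IsPiece T a) : a.length ≤ N ∧ decays k (a.map code) = true := by
  obtain ⟨-, q, hq, ha⟩ := h
  obtain ⟨m, hm, hd⟩ := hq.acceptedDecay hT
  cases m with
  | zero => simp [acceptedDecay] at hd
  | succ m =>
    rw [List.length_map] at hm
    refine ⟨by omega, ?_⟩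
    rw [acceptedDecay, Bool.and_eq_true, ha] at hd
    simpa using hd.1

/-! ### From pieces of nine-day-old strings to their atoms -/

/-- Nine-day-old strings are cut into pieces that are accepted by the last automaton. -/
theorem decomposes_nine_days (w : List ℤ) : Decomposes (IsPiece table9) (JHC^[9] w) := by
  have h2 : Decomposes (IsPiece table2) (JHC^[2] w) := exists_pieces_JHC_JHC check2 w
  have h3 : Decomposes (IsPiece table3) (JHC^[3] w) := by
    rw [Function.iterate_succ_apply']
    exact h2.of_check check3
  have h4 : Decomposes (IsPiece table4) (JHC^[4] w) := by
    rw [Function.iterate_succ_apply']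
    exact h3.of_check check4
  have h5 : Decomposes (IsPiece table5) (JHC^[5] w) := by
    rw [Function.iterate_succ_apply']
    exact h4.of_check check5
  have h6 : Decomposes (IsPiece table6) (JHC^[6] w) := by
    rw [Function.iterate_succ_apply']
    exact h5.of_check check6
  have h7 : Decomposes (IsPiece table7) (JHC^[7] w) := by
    rw [Function.iterate_succ_apply']
    exact h6.of_check check7
  have h8 : Decomposes (IsPiece table8) (JHC^[8] w) := by
    rw [Function.iterate_succ_apply']
    exact h7.of_check check8
  have h9 : Decomposes (IsPiece table9) (JHC^[9] w) := by
    rw [Function.iterate_succ_apply']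
    exact h8.of_check check9
  exact h9

theorem IsPiece.length_le_and_decomposes {a : List ℤ} (h : IsPiece table9 a) :
    a.length ≤ 80 ∧ Decomposes IsFinalString (JHC^[20] a) := by
  have hT := acceptedDecay_table9
  rw [forceNat_eq] at hT
  obtain ⟨h1, h2⟩ := IsPiece.decays (N := 80) hT h
  obtain ⟨n, hn, hw⟩ := h.1.exists_decode
  refine ⟨h1, ?_⟩
  rw [← hw]
  exact decomposes_of_decays hn h2

theorem SepChain.of_flatten_mem {d : List (List (List ℤ))} (h : SepChain d.flatten)
    {l : List (List ℤ)} (hl : l ∈ d) : SepChain l := by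
  have h' : l <:+: d.flatten := List.infix_of_mem_flatten hl
  exact ⟨fun h0 => h.1 (h'.subset h0), h.2.infix h'⟩

theorem mainTheorem2 (w : List ℤ) (l : List (List ℤ)) (hl : IsSplitting (JHC^[9] w) l)
    (a : List ℤ) (ha : a ∈ l) :
    a.length ≤ 80 ∧
      ∃ k : ℕ, k ≤ 20 ∧ ∃ m : List (List ℤ), IsSplitting (JHC^[k] a) m ∧
        ∀ b ∈ m, IsStable b ∨ IsTransuranic b := by
  have hsep := hl.sepChain
  obtain ⟨p, hp, hpsep, hpp⟩ := decomposes_nine_days w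
  -- The given atoms are grouped into the pieces; `e` below is the group that contains `a`.
  obtain ⟨d, rfl, rfl⟩ := hsep.exists_refine hl.2.1 hpsep (hl.1.trans hp.symm)
  obtain ⟨e, he, hae⟩ := List.mem_flatten.1 ha
  obtain ⟨hlen, q, hq, hqsep, hqf⟩ :=
    (hpp e.flatten (List.mem_map.2 ⟨e, he, rfl⟩)).length_le_and_decomposes
  have hesep : SepChain e := hsep.of_flatten_mem he
  -- The bound on days is used uniformly: `20` days work for every atom, since final strings decay
  -- into final strings.
  refine ⟨le_trans ?_ hlen, 20, le_rfl, ?_⟩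
  · exact (List.sublist_flatten_of_mem hae).length_le
  -- After `20` days the piece is cut in two ways: into final strings, which are atoms, and into the
  -- descendants of the atoms in `e`. The first cutting refines the second, and `m` is the part that
  -- lies over `a`.
  obtain ⟨f, rfl, hf⟩ := hqsep.exists_refine (fun b hb => (hqf b hb).isElement)
    (hesep.iterate 20) (by rw [hq, hesep.iterate_flatten])
  obtain ⟨m, hm, hma⟩ := List.mem_map.1
    (show JHC^[20] a ∈ f.map List.flatten from hf ▸ List.mem_map.2 ⟨a, hae, rfl⟩)
  have hmf : ∀ b ∈ m, IsFinalString b := fun b hb => hqf b (List.mem_flatten.2 ⟨m, hm, hb⟩)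
  refine ⟨m, ?_, fun b hb => (hmf b hb).isStable_or_isTransuranic⟩
  rw [← hma]
  exact (hqsep.of_flatten_mem hm).isSplitting fun b hb => (hmf b hb).isElement
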